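/- All graphs are finite and simple. A cactus is a connected graph in which any two distinct cycles have at most one common vertex. For vertices $u,v,w$ let $d(u,w)$ be the distance in $G$, and for an edge $f=xy$ put $d(f,w)=\min\{d(x,w),d(y,w)\}$. For an edge $uv$ of $G$ let $n_u(uv)$ be the number of vertices $w$ with $d(u,w)<d(v,w)$, and let $m_u(uv)$ be the number of edges $f$ with $d(f,u)<d(f,v)$; define $n_v(uv)$ and $m_v(uv)$ symmetrically. The edge Szeged index and the edge-vertex Szeged index of $G$ are $$Sz_e(G)=\sum_{uv\in E(G)} m_u(uv)\,m_v(uv),\qquad Sz_{ev}(G)=\frac12\sum_{uv\in E(G)}\bigl[n_u(uv)\,m_v(uv)+n_v(uv)\,m_u(uv)\bigr].$$ Theorem. Let $G$ be a cactus with $n\ge 5$ vertices and exactly $k\ge 0$ cycles. Then $$Sz_e(G)\ \ge\ 2kn+2k^2-5k,\qquad Sz_{ev}(G)\ \ge\ \tfrac12\left(n^2-3n+3kn-5k+2\right).$$ In each of the two inequalities, equality holds if and only if $G$ is isomorphic to $C_0(n,k)$, the graph consisting of $k$ triangles sharing one common vertex, and otherwise disjoint, together with $n-2k-1$ pendant edges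 attached at that common vertex (for $k=0$, the star on $n$ vertices). -/

import Mathlib

namespace SimpleGraph

variable {V : Type*}

/-- The cycles of `G`, as subgraphs: a cycle has no base point and no orientation. -/
def cycleSubgraphs (G : SimpleGraph V) : Set G.Subgraph :=
  {C | ∃ (v : V) (p : G.Walk v v), p.IsCycle ∧ p.toSubgraph = C}

/-- A cactus: a connected graph in which any two distinct cycles have at most one common vertex. -/
structure IsCactus (G : SimpleGraph V) : Prop where
  connected : G.Connected
  inter_subsingleton : ∀ C ∈ G.cycleSubgraphs, ∀ D ∈ G.cycleSubgraphs, C ≠ D →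
    (C.verts ∩ D.verts).Subsingleton

/-- The class of cacti of order `n` with exactly `k` cycles. -/
structure IsCactusOfOrder (G : SimpleGraph V) [Fintype V] (n k : ℕ) : Prop where
  isCactus : G.IsCactus
  card_verts : Fintype.card V = n
  card_cycles : G.cycleSubgraphs.ncard = k

/-- The distance between an edge `e = uv` and a vertex `w`: `min (d(u, w)) (d(v, w))`. -/
noncomputable def edgeVertDist (G : SimpleGraph V) (e : Sym2 V) (w : V) : ℕ :=
  Sym2.lift ⟨fun u v => min (G.dist u w) (G.dist v w), fun _ _ => min_comm _ _⟩ e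

/-- `n_u(uv|G)`: the number of vertices closer to `u` than to `v`. -/
noncomputable def vertCloser (G : SimpleGraph V) (u v : V) : ℕ :=
  {w : V | G.dist u w < G.dist v w}.ncard

/-- `m_u(uv|G)`: the number of edges closer to `u` than to `v`. -/
noncomputable def edgeCloser (G : SimpleGraph V) (u v : V) : ℕ :=
  {f : Sym2 V | f ∈ G.edgeSet ∧ G.edgeVertDist f u < G.edgeVertDist f v}.ncard

/-- The edge Szeged index. -/
noncomputable def edgeSzeged (G : SimpleGraph V) [Fintype G.edgeSet] : ℕ :=
  ∑ e ∈ G.edgeFinset,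
    Sym2.lift ⟨fun u v => G.edgeCloser u v * G.edgeCloser v u, fun _ _ => Nat.mul_comm _ _⟩ e

/-- The edge-vertex Szeged index. -/
noncomputable def edgeVertexSzeged (G : SimpleGraph V) [Fintype G.edgeSet] : ℚ :=
  (1 / 2) * ∑ e ∈ G.edgeFinset,
    ((Sym2.lift ⟨fun u v => G.vertCloser u v * G.edgeCloser v u +
        G.vertCloser v u * G.edgeCloser u v, fun _ _ => Nat.add_comm _ _⟩ e : ℕ) : ℚ)

/-- `k` triangles sharing one vertex, with `p` pendant edges attached at that vertex. The common
vertex is `none`; the other two vertices of the `i`-th triangle are `(i, false)` and `(i, true)`. -/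
def triangleBundle (k p : ℕ) : SimpleGraph (Option ((Fin k × Bool) ⊕ Fin p)) :=
  SimpleGraph.fromRel fun x y =>
    x = none ∨ ∃ i : Fin k, x = some (Sum.inl (i, false)) ∧ y = some (Sum.inl (i, true))

/-- `C₀(n, k)`, of order `n` for `2 * k + 1 ≤ n` (which holds for all cacti of order `n` with
`k` cycles). -/
def extremalCactus (n k : ℕ) : SimpleGraph (Option ((Fin k × Bool) ⊕ Fin (n - 2 * k - 1))) :=
  triangleBundle k (n - 2 * k - 1)

end SimpleGraph

/-! Write `m` for the number of edges. For an edge `uv`, `m_u m_v = (m_u - 1)(m_v - 1) + (m_u + m_v)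
- 1`, and `m_u + m_v` is `m` minus the number of edges `f` equidistant from `u` and `v`, that is,
those for which `uv` is level for the distance to `f`. Summing over a cycle `C` and exchanging the
sums, it remains to count, for each `f`, the edges of `C` level for `f`.

A cactus has exactly as many cycles as edges outside a breadth-first tree rooted at `f`. Its cycles
are edge-disjoint and each needs such an edge, so each has exactly one
(`IsCactus.card_cycle_inter_cotreeEdges`). Level edges other than `f` lie outside the tree, so at
most one of them is on `C`, and a parity argument settles the number. Hence the sums over `C` depend
only on the length of `C`, on `m` and on the order (`IsCactus.sum_edgeCloserSum`,
`IsCactus.sum_vertCloserSum`). The products `(m_u - 1)(m_v - 1)` are nonnegative on cycles, and for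
order at least 5 triangles give the least total. Edges on no cycle contribute at least 0, or at
least `m - 1` to twice the edge-vertex index. Adding up with `m = n + k - 1` gives both bounds.

In the case of equality all cycles are triangles and one end of every edge is so restricted that the
closed neighbourhoods of adjacent vertices are nested. This forces a universal vertex
(`Connected.exists_universal`), and a cactus with a universal vertex is `C₀(n, k)`. Conversely, all
the equality conditions hold around a universal vertex. -/

namespace SimpleGraph

variable {V : Type*} {G : SimpleGraph V}

/-! ### Cycles as subgraphs -/

lemma verts_nonempty_of_mem_cycleSubgraphs {C : G.Subgraph} (hC : C ∈ G.cycleSubgraphs) :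
    C.verts.Nonempty := by
  obtain ⟨v, p, -, rfl⟩ := hC
  exact ⟨v, p.start_mem_verts_toSubgraph⟩

lemma ncard_neighborSet_of_mem_cycleSubgraphs {C : G.Subgraph} (hC : C ∈ G.cycleSubgraphs)
    {v : V} (hv : v ∈ C.verts) : (C.neighborSet v).ncard = 2 := by
  obtain ⟨u, p, hp, rfl⟩ := hC
  exact hp.ncard_neighborSet_toSubgraph_eq_two (p.mem_verts_toSubgraph.1 hv)

lemma exists_two_adj_of_mem_cycleSubgraphs {C : G.Subgraph} (hC : C ∈ G.cycleSubgraphs)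
    {v : V} (hv : v ∈ C.verts) : ∃ x y, x ≠ y ∧ C.Adj v x ∧ C.Adj v y := by
  obtain ⟨x, y, hxy, h⟩ := Set.ncard_eq_two.1 (ncard_neighborSet_of_mem_cycleSubgraphs hC hv)
  refine ⟨x, y, hxy, ?_, ?_⟩ <;> rw [← Subgraph.mem_neighborSet, h] <;> simp

lemma exists_adj_ne_of_mem_cycleSubgraphs {C : G.Subgraph} (hC : C ∈ G.cycleSubgraphs)
    {u v : V} (h : C.Adj u v) : ∃ x, x ≠ v ∧ C.Adj u x := by
  obtain ⟨x, y, hxy, hx, hy⟩ := exists_two_adj_of_mem_cycleSubgraphs hC h.fst_mem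
  by_cases hxv : x = v
  · exact ⟨y, fun hyv => hxy (hxv.trans hyv.symm), hy⟩
  · exact ⟨x, hxv, hx⟩

/-- The edges of a subgraph of a finite graph, as a finset. -/
noncomputable def Subgraph.edges [Finite V] (C : G.Subgraph) : Finset (Sym2 V) :=
  C.edgeSet.toFinite.toFinset

@[simp] lemma Subgraph.mem_edges [Finite V] {C : G.Subgraph} {e : Sym2 V} :
    e ∈ C.edges ↔ e ∈ C.edgeSet := by
  simp [Subgraph.edges]

lemma Walk.edges_toSubgraph [Finite V] [DecidableEq V] {v : V} {p : G.Walk v v} :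
    p.toSubgraph.edges = p.edges.toFinset := by
  ext e
  simp

lemma three_le_card_edges_of_mem_cycleSubgraphs [Finite V] {C : G.Subgraph}
    (hC : C ∈ G.cycleSubgraphs) : 3 ≤ C.edges.card := by
  classical
  obtain ⟨u, p, hp, rfl⟩ := hC
  rw [Walk.edges_toSubgraph, List.toFinset_card_of_nodup hp.edges_nodup,
    Walk.length_edges]
  exact hp.three_le_length

/-- The two ends of `e` have the same value under `g`. -/
def IsLevel (g : V → ℕ) (e : Sym2 V) : Prop := (e.map g).IsDiag

@[simp] lemma isLevel_mk {g : V → ℕ} {u v : V} : IsLevel g s(u, v) ↔ g u = g v := by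
  simp [IsLevel]

/-- A level step adds 2 to the left side and keeps `g`; any other step adds 1 and changes the parity
of `g`. -/
lemma Walk.countP_isLevel_add {g : V → ℕ} [DecidablePred (IsLevel g)]
    (hg : ∀ u v, G.Adj u v → g u = g v ∨ g u = g v + 1 ∨ g v = g u + 1) {u v : V}
    (p : G.Walk u v) :
    (p.edges.countP (fun e => IsLevel g e) + p.length) % 2 = (g u + g v) % 2 := by
  induction p with
  | nil => simp; lia
  | @cons u v w h p ih =>
    rw [Walk.edges_cons, List.countP_cons, Walk.length_cons]
    rcases hg u v h with h | h | h <;> simp [h] <;> lia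

/-- Along a cycle, the number of level edges of a function that changes by at most one along edges
has the parity of the length. -/
lemma card_filter_isLevel_mod_two [Finite V] {g : V → ℕ}
    (hg : ∀ u v, G.Adj u v → g u = g v ∨ g u = g v + 1 ∨ g v = g u + 1) {C : G.Subgraph}
    (hC : C ∈ G.cycleSubgraphs) [DecidablePred (IsLevel g)] :
    (C.edges.filter (IsLevel g)).card % 2 = C.edges.card % 2 := by
  classical
  obtain ⟨u, p, hp, rfl⟩ := hC
  have h := p.countP_isLevel_add hg
  have h1 : (p.toSubgraph.edges.filter (IsLevel g)).card
      = p.edges.countP (fun e => IsLevel g e) := by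
    rw [Walk.edges_toSubgraph, List.countP_eq_length_filter,
      ← List.toFinset_card_of_nodup (hp.edges_nodup.filter _), List.toFinset_filter]
    congr 1
    ext e
    simp
  have h2 : p.toSubgraph.edges.card = p.length := by
    rw [Walk.edges_toSubgraph, List.toFinset_card_of_nodup hp.edges_nodup,
      Walk.length_edges]
  rw [h1, h2]
  lia

/-- In a cycle with three edges, every edge spans a triangle with any other edge at its first
end. -/
lemma adj_of_card_edges_eq_three [Finite V] {C : G.Subgraph} (hC : C ∈ G.cycleSubgraphs)
    (h3 : C.edges.card = 3) {u v z : V} (huv : C.Adj u v) (hz : z ≠ v) (huz : C.Adj u z) :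
    C.Adj v z := by
  classical
  obtain ⟨y, hy, hvy⟩ := exists_adj_ne_of_mem_cycleSubgraphs hC huv.symm
  obtain ⟨x, hx, hzx⟩ := exists_adj_ne_of_mem_cycleSubgraphs hC huz.symm
  by_contra hvz
  have hyz : y ≠ z := fun h => hvz (h ▸ hvy)
  have hxv : x ≠ v := fun h => hvz (h ▸ hzx).symm
  -- If `v` and `z` were not joined in `C`, their further neighbours would yield four distinct
  -- edges.
  have hsub : ({s(u, v), s(u, z), s(v, y), s(z, x)} : Finset (Sym2 V)) ⊆ C.edges := by
    intro e he
    simp only [Finset.mem_insert, Finset.mem_singleton] at he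
    rcases he with rfl | rfl | rfl | rfl <;> simpa
  have hcard := Finset.card_le_card hsub
  have := huv.ne
  have := huz.ne
  rw [Finset.card_insert_of_notMem, Finset.card_insert_of_notMem, Finset.card_insert_of_notMem,
    Finset.card_singleton] at hcard
  · lia
  all_goals
    simp only [Finset.mem_insert, Finset.mem_singleton, Sym2.eq_iff]
    grind

/-- A triangle is a cycle. -/
lemma exists_cycle_of_triangle {a b c : V} (hab : G.Adj a b) (hbc : G.Adj b c) (hca : G.Adj c a) :
    ∃ C ∈ G.cycleSubgraphs, C.Adj a b ∧ C.Adj b c ∧ C.Adj c a ∧ C.verts = {a, b, c} := by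
  refine ⟨_, ⟨a, .cons hab (.cons hbc (.cons hca .nil)), ?_, rfl⟩, ?_, ?_, ?_, ?_⟩
  · have := hab.ne
    have := hbc.ne
    have := hca.ne
    simp [Walk.cons_isCycle_iff, Walk.cons_isPath_iff]
    grind
  · simp
  · simp
  · simp
  · ext x
    simp only [Walk.mem_verts_toSubgraph]
    simp
    grind

namespace IsCactus

lemma eq_of_adj (hG : G.IsCactus) {C D : G.Subgraph} (hC : C ∈ G.cycleSubgraphs)
    (hD : D ∈ G.cycleSubgraphs) {u v : V} (hCe : C.Adj u v) (hDe : D.Adj u v) : C = D := by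
  by_contra h
  exact hCe.ne (hG.inter_subsingleton C hC D hD h ⟨hCe.fst_mem, hDe.fst_mem⟩
    ⟨hCe.snd_mem, hDe.snd_mem⟩)

lemma disjoint_edges [Finite V] (hG : G.IsCactus) {C D : G.Subgraph}
    (hC : C ∈ G.cycleSubgraphs) (hD : D ∈ G.cycleSubgraphs) (h : C ≠ D) : Disjoint C.edges D.edges := by
  rw [Finset.disjoint_left]
  intro e
  induction e with | _ u v
  simp only [Subgraph.mem_edges, Subgraph.mem_edgeSet]
  exact fun h1 h2 => h (hG.eq_of_adj hC hD h1 h2)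

end IsCactus

end SimpleGraph

namespace SimpleGraph

variable {V : Type*} {G : SimpleGraph V}

/-! ### Breadth-first spanning trees rooted at a vertex or at an edge

An edge and a vertex are treated alike: the vertex `w` is the degenerate edge `s(w, w)`. -/

@[simp] lemma edgeVertDist_mk (u v w : V) :
    G.edgeVertDist s(u, v) w = min (G.dist u w) (G.dist v w) := rfl

lemma Connected.edgeVertDist_eq_zero_iff (hG : G.Connected) {f : Sym2 V} {w : V} :
    G.edgeVertDist f w = 0 ↔ w ∈ f := by
  induction f with | _ x y
  simp only [edgeVertDist_mk, Sym2.mem_iff]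
  rw [Nat.min_eq_zero_iff, hG.dist_eq_zero_iff, hG.dist_eq_zero_iff]
  grind

lemma Connected.dist_le_dist_add_one (hG : G.Connected) {u v : V} (h : G.Adj u v) (x : V) :
    G.dist x u ≤ G.dist x v + 1 := by
  have h1 := hG.dist_triangle (u := x) (v := v) (w := u)
  have h2 := dist_eq_one_iff_adj.2 h.symm
  lia

lemma Connected.edgeVertDist_adj (hG : G.Connected) (f : Sym2 V) (u v : V) (h : G.Adj u v) :
    G.edgeVertDist f u = G.edgeVertDist f v ∨ G.edgeVertDist f u = G.edgeVertDist f v + 1 ∨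
      G.edgeVertDist f v = G.edgeVertDist f u + 1 := by
  induction f with | _ x y
  simp only [edgeVertDist_mk]
  have := hG.dist_le_dist_add_one h x
  have := hG.dist_le_dist_add_one h y
  have := hG.dist_le_dist_add_one h.symm x
  have := hG.dist_le_dist_add_one h.symm y
  lia

lemma Connected.exists_adj_dist_lt (hG : G.Connected) {x v : V} (h : x ≠ v) :
    ∃ u, G.Adj v u ∧ G.dist x u < G.dist x v := by
  obtain ⟨p, hp⟩ := hG.exists_walk_length_eq_dist v x
  cases p with
  | nil => exact absurd rfl h
  | @cons _ u _ ha q =>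
    refine ⟨u, ha, ?_⟩
    rw [dist_comm, dist_comm (u := x), ← hp, Walk.length_cons]
    exact Nat.lt_succ_of_le (dist_le q)

lemma Connected.exists_adj_edgeVertDist_lt (hG : G.Connected) {f : Sym2 V} {v : V} (h : v ∉ f) :
    ∃ u, G.Adj v u ∧ G.edgeVertDist f u < G.edgeVertDist f v := by
  induction f with | _ x y
  simp only [Sym2.mem_iff, not_or] at h
  obtain ⟨a, ha, ha'⟩ := hG.exists_adj_dist_lt (Ne.symm h.1)
  obtain ⟨b, hb, hb'⟩ := hG.exists_adj_dist_lt (Ne.symm h.2)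
  simp only [edgeVertDist_mk]
  rcases le_total (G.dist x v) (G.dist y v) with hle | hle
  · exact ⟨a, ha, by lia⟩
  · exact ⟨b, hb, by lia⟩

open Classical in
/-- A neighbour of `v` that is closer to `f`, if there is one. -/
noncomputable def bfsParent (G : SimpleGraph V) (f : Sym2 V) (v : V) : V :=
  if h : ∃ u, G.Adj v u ∧ G.edgeVertDist f u < G.edgeVertDist f v then h.choose else v

lemma Connected.adj_bfsParent (hG : G.Connected) {f : Sym2 V} {v : V} (h : v ∉ f) :
    G.Adj v (G.bfsParent f v) := by
  have h' := hG.exists_adj_edgeVertDist_lt h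
  rw [bfsParent, dif_pos h']
  exact h'.choose_spec.1

lemma Connected.edgeVertDist_bfsParent_lt (hG : G.Connected) {f : Sym2 V} {v : V} (h : v ∉ f) :
    G.edgeVertDist f (G.bfsParent f v) < G.edgeVertDist f v := by
  have h' := hG.exists_adj_edgeVertDist_lt h
  rw [bfsParent, dif_pos h']
  exact h'.choose_spec.2

lemma Connected.isLevel_self (hG : G.Connected) (f : Sym2 V) :
    IsLevel (G.edgeVertDist f) f := by
  have h (w : V) (hw : w ∈ f) := hG.edgeVertDist_eq_zero_iff.2 hw
  induction f with | _ x y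
  rw [isLevel_mk, h x (by simp), h y (by simp)]

variable [Fintype V]

open Classical in
/-- The edges joining the vertices outside `f` to their parents. -/
noncomputable def bfsEdges (G : SimpleGraph V) (f : Sym2 V) : Finset (Sym2 V) :=
  (Finset.univ.filter (· ∉ f)).image fun v => s(v, G.bfsParent f v)

lemma mem_bfsEdges {f e : Sym2 V} :
    e ∈ G.bfsEdges f ↔ ∃ v, v ∉ f ∧ s(v, G.bfsParent f v) = e := by
  simp [bfsEdges]

lemma Connected.mem_bfsEdges_of_le (hG : G.Connected) {f : Sym2 V} {u v : V}
    (hle : G.edgeVertDist f u ≤ G.edgeVertDist f v) (h : s(v, u) ∈ G.bfsEdges f) :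
    u = G.bfsParent f v := by
  obtain ⟨x, hx, hxe⟩ := mem_bfsEdges.1 h
  have := hG.edgeVertDist_bfsParent_lt hx
  rcases Sym2.eq_iff.1 hxe with ⟨rfl, h2⟩ | ⟨rfl, h2⟩
  · exact h2.symm
  · rw [h2] at this
    lia

lemma Connected.not_isLevel_of_mem_bfsEdges (hG : G.Connected) {f e : Sym2 V}
    (h : e ∈ G.bfsEdges f) : ¬ IsLevel (G.edgeVertDist f) e := by
  obtain ⟨x, hx, rfl⟩ := mem_bfsEdges.1 h
  have := hG.edgeVertDist_bfsParent_lt hx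
  simp only [isLevel_mk]
  lia

lemma Connected.card_bfsEdges (hG : G.Connected) (f : Sym2 V) [DecidablePred (· ∉ f)] :
    (G.bfsEdges f).card = (Finset.univ.filter (· ∉ f)).card := by
  classical
  rw [bfsEdges, Finset.card_image_of_injOn]
  · congr
  · intro u hu v hv huv
    simp only [Finset.coe_filter, Finset.mem_univ, true_and, Set.mem_ofPred_eq] at hu hv
    have h1 := hG.edgeVertDist_bfsParent_lt hu
    have h2 := hG.edgeVertDist_bfsParent_lt hv
    rcases Sym2.eq_iff.1 huv with ⟨h, -⟩ | ⟨h, h'⟩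
    · exact h
    · rw [h'] at h1
      rw [← h] at h2
      lia

open Classical in
/-- The edges outside the breadth-first tree rooted at `f`. -/
noncomputable def cotreeEdges (G : SimpleGraph V) (f : Sym2 V) : Finset (Sym2 V) :=
  G.edgeSet.toFinite.toFinset \ insert f (G.bfsEdges f)

lemma mem_cotreeEdges {f e : Sym2 V} :
    e ∈ G.cotreeEdges f ↔ e ∈ G.edgeSet ∧ e ≠ f ∧ e ∉ G.bfsEdges f := by
  simp [cotreeEdges]

lemma Connected.bfsEdges_subset (hG : G.Connected) {f e : Sym2 V} (h : e ∈ G.bfsEdges f) :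
    e ∈ G.edgeSet := by
  obtain ⟨x, hx, rfl⟩ := mem_bfsEdges.1 h
  exact hG.adj_bfsParent hx

/-- The tree has one edge per vertex outside `f`, plus `f` itself when `f` is a genuine edge: `|V| -
1` edges in both cases. A diagonal `f` is not an edge, so removing it changes nothing. -/
lemma Connected.card_cotreeEdges (hG : G.Connected) {f : Sym2 V} (hf : f.IsDiag ∨ f ∈ G.edgeSet)
    [Fintype G.edgeSet] : (G.cotreeEdges f).card + Fintype.card V = G.edgeFinset.card + 1 := by
  classical
  have hE : G.edgeSet.toFinite.toFinset = G.edgeFinset := by ext; simp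
  have hcard := hG.card_bfsEdges f
  have hnot : f ∉ G.bfsEdges f := fun h => hG.not_isLevel_of_mem_bfsEdges h (hG.isLevel_self f)
  have hsub : G.bfsEdges f ⊆ G.edgeFinset := fun e he => by
    simpa using hG.bfsEdges_subset he
  have hle := Finset.card_le_card hsub
  rw [cotreeEdges, hE]
  have hcompl := Finset.card_filter_add_card_filter_not (s := Finset.univ) (p := (· ∈ f))
  rw [Finset.card_univ] at hcompl
  by_cases hd : f.IsDiag
  · have hfE : f ∉ G.edgeFinset := by
      rw [mem_edgeFinset]
      exact fun h => G.not_isDiag_of_mem_edgeSet h hd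
    rw [Finset.sdiff_insert_of_notMem hfE, Finset.card_sdiff_of_subset hsub]
    have : (Finset.univ.filter (· ∈ f)).card = 1 := by
      induction f with | _ x y
      obtain rfl : x = y := by simpa using hd
      rw [Finset.card_eq_one]
      exact ⟨x, by ext; simp⟩
    lia
  · have hfE : f ∈ G.edgeSet := hf.resolve_left hd
    have hsub' : insert f (G.bfsEdges f) ⊆ G.edgeFinset :=
      Finset.insert_subset (by simpa using hfE) hsub
    have hle' := Finset.card_le_card hsub'
    rw [Finset.card_sdiff_of_subset hsub']
    rw [Finset.card_insert_of_notMem hnot] at hle' ⊢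
    have : (Finset.univ.filter (· ∈ f)).card = 2 := by
      induction f with | _ x y
      rw [Finset.card_eq_two]
      exact ⟨x, y, by simpa using hd, by ext; simp⟩
    lia

/-- Every cycle has an edge outside the breadth-first tree. -/
lemma Connected.exists_mem_cotreeEdges (hG : G.Connected) (f : Sym2 V) {C : G.Subgraph}
    (hC : C ∈ G.cycleSubgraphs) : ∃ e ∈ C.edges, e ∈ G.cotreeEdges f := by
  -- At a vertex `z` of the cycle farthest from `f`, only the cycle edge going to the parent of `z`
  -- can be a tree edge, and `z` has two cycle edges.
  obtain ⟨z, hz, hmax⟩ := C.verts.toFinite.exists_maximalFor (G.edgeVertDist f) _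
    (verts_nonempty_of_mem_cycleSubgraphs hC)
  replace hmax (x : V) (hx : x ∈ C.verts) : G.edgeVertDist f x ≤ G.edgeVertDist f z := by
    by_contra! h
    exact absurd (hmax hx h.le) (by simpa using h)
  obtain ⟨x, y, hxy, hx, hy⟩ := exists_two_adj_of_mem_cycleSubgraphs hC hz
  by_cases hzf : z ∈ f
  -- Here the whole cycle would lie inside `f`, which has at most two ends.
  · have h0 : G.edgeVertDist f z = 0 := hG.edgeVertDist_eq_zero_iff.2 hzf
    have hmem (a : V) (ha : a ∈ C.verts) : a ∈ f :=
      hG.edgeVertDist_eq_zero_iff.1 (by have := hmax a ha; lia)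
    have h1 := hmem x hx.snd_mem
    have h2 := hmem y hy.snd_mem
    have := hx.ne
    have := hy.ne
    induction f with | _ a b
    simp only [Sym2.mem_iff] at hzf h1 h2
    grind
  · have key (a : V) (ha : C.Adj z a) (hne : a ≠ G.bfsParent f z) :
        ∃ e ∈ C.edges, e ∈ G.cotreeEdges f := by
      refine ⟨s(z, a), by simpa using ha, mem_cotreeEdges.2 ⟨ha.adj_sub, ?_, fun h => ?_⟩⟩
      · rintro rfl
        simp at hzf
      · exact hne (hG.mem_bfsEdges_of_le (hmax a ha.snd_mem) h)
    by_cases hxp : x = G.bfsParent f z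
    · exact key y hy (fun h => hxy (hxp.trans h.symm))
    · exact key x hx hxp

/-- The vertices are connected to the root through tree edges. -/
lemma Connected.reachable_bfsEdges (hG : G.Connected) (w v : V) :
    (fromEdgeSet (G.bfsEdges s(w, w) : Set (Sym2 V))).Reachable v w := by
  induction h : G.edgeVertDist s(w, w) v using Nat.strong_induction_on generalizing v with
  | _ d ih =>
    by_cases hv : v ∈ s(w, w)
    · obtain rfl : v = w := by simpa using hv
      rfl
    · have hlt := hG.edgeVertDist_bfsParent_lt hv
      refine Reachable.trans (Adj.reachable ?_) (ih _ (h ▸ hlt) _ rfl)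
      rw [fromEdgeSet_adj]
      exact ⟨mem_bfsEdges.2 ⟨v, hv, rfl⟩, (hG.adj_bfsParent hv).ne⟩

/-- Every edge outside the tree is the only such edge of some cycle. -/
lemma Connected.exists_fundamental_cycle (hG : G.Connected) (w : V) {e : Sym2 V}
    (he : e ∈ G.cotreeEdges s(w, w)) :
    ∃ C ∈ G.cycleSubgraphs, e ∈ C.edges ∧ ∀ e' ∈ C.edges, e' ∈ G.cotreeEdges s(w, w) → e' = e := by
  classical
  obtain ⟨heE, -, heT⟩ := mem_cotreeEdges.1 he
  induction e with | _ u v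
  -- `H` is the tree together with `e`. The tree already connects the ends of `e`, so `e` lies on a
  -- cycle of `H`.
  set H : SimpleGraph V := fromEdgeSet (insert s(u, v) (G.bfsEdges s(w, w) : Set (Sym2 V)))
  have hHG : H ≤ G := by
    intro a b hab
    rw [fromEdgeSet_adj] at hab
    rcases hab.1 with h | h
    · rw [← mem_edgeSet, h]
      exact heE
    · exact hG.bfsEdges_subset h
  have hle : fromEdgeSet (G.bfsEdges s(w, w) : Set (Sym2 V)) ≤ H \ fromEdgeSet {s(u, v)} := by
    intro a b hab
    rw [fromEdgeSet_adj] at hab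
    rw [sdiff_adj, fromEdgeSet_adj, fromEdgeSet_adj]
    refine ⟨⟨Or.inr hab.1, hab.2⟩, fun h => heT ?_⟩
    rw [← h.1]
    exact hab.1
  have hreach := ((hG.reachable_bfsEdges w u).trans (hG.reachable_bfsEdges w v).symm).mono hle
  have hadj : H.Adj u v := by
    rw [fromEdgeSet_adj]
    exact ⟨Or.inl rfl, G.ne_of_adj heE⟩
  obtain ⟨x, p, hp, hpe⟩ := adj_and_reachable_delete_edges_iff_exists_cycle.1 ⟨hadj, hreach⟩
  refine ⟨_, ⟨x, p.mapLe hHG, hp.mapLe hHG, rfl⟩, ?_, ?_⟩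
  · simpa [Walk.edges_toSubgraph] using hpe
  · intro e' he' hco
    have he'p : e' ∈ p.edges := by simpa [Walk.edges_toSubgraph] using he'
    have hH := p.edges_subset_edgeSet he'p
    rw [edgeSet_fromEdgeSet] at hH
    rcases hH.1 with h | h
    · exact h
    · exact absurd h (mem_cotreeEdges.1 hco).2.2

/-- The cycles of a finite graph. -/
noncomputable def cycleFinset (G : SimpleGraph V) : Finset G.Subgraph :=
  G.cycleSubgraphs.toFinite.toFinset

@[simp] lemma mem_cycleFinset {C : G.Subgraph} :
    C ∈ G.cycleFinset ↔ C ∈ G.cycleSubgraphs := by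
  simp [cycleFinset]

lemma card_cycleFinset : G.cycleFinset.card = G.cycleSubgraphs.ncard :=
  (Set.ncard_eq_toFinset_card _ (Set.toFinite _)).symm

lemma Subgraph.edges_subset {C : G.Subgraph} {e : Sym2 V} (h : e ∈ C.edges) :
    e ∈ G.edgeSet :=
  C.edgeSet_subset (by simpa using h)

/-! ### Cycles of a cactus, cotree edges and level edges. -/

namespace IsCactus

/-- A cactus has as many cycles as edges outside a spanning tree. -/
lemma card_edgeFinset_add_one (hG : G.IsCactus) [Fintype G.edgeSet] :
    G.cycleSubgraphs.ncard + Fintype.card V = G.edgeFinset.card + 1 := by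
  classical
  obtain ⟨w⟩ := hG.connected.nonempty
  have : Nonempty (Sym2 V) := ⟨s(w, w)⟩
  rw [← hG.connected.card_cotreeEdges (f := s(w, w)) (Or.inl (by simp)), add_left_inj,
    Set.ncard_eq_toFinset_card _ (Set.toFinite _)]
  apply le_antisymm
  · choose! φ hφ hφ' using fun C hC =>
      hG.connected.exists_mem_cotreeEdges s(w, w) (C := C) hC
    apply Finset.card_le_card_of_injOn φ
    · intro C hC
      exact hφ' C (by simpa using hC)
    · intro C hC D hD hCD
      simp only [Set.Finite.coe_toFinset] at hC hD
      by_contra hne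
      exact Finset.disjoint_left.1 (hG.disjoint_edges hC hD hne) (hφ C hC) (hCD ▸ hφ D hD)
  · choose! φ hφ hφ' hφ'' using fun e he =>
      hG.connected.exists_fundamental_cycle w (e := e) he
    apply Finset.card_le_card_of_injOn φ
    · intro e he
      simpa using hφ e he
    · intro e he e' he' h
      exact (hφ'' e' he' e (h ▸ hφ' e he) he)

lemma pairwiseDisjoint_edges (hG : G.IsCactus) :
    (G.cycleFinset : Set G.Subgraph).PairwiseDisjoint Subgraph.edges := by
  intro C hC D hD hne
  simp only [Finset.mem_coe, mem_cycleFinset] at hC hD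
  exact hG.disjoint_edges hC hD hne

/-- The cotree has as many edges as there are cycles, and the cycles meet it in disjoint nonempty
sets; so these sets are singletons and exhaust it. -/
lemma card_cycle_inter_cotreeEdges (hG : G.IsCactus) [DecidableEq (Sym2 V)] {f : Sym2 V}
    (hf : f.IsDiag ∨ f ∈ G.edgeSet) :
    (∀ C ∈ G.cycleSubgraphs, (C.edges ∩ G.cotreeEdges f).card = 1) ∧
      ∀ e ∈ G.cotreeEdges f, ∃ C ∈ G.cycleSubgraphs, e ∈ C.edges := by
  classical
  have hpos (C) (hC : C ∈ G.cycleFinset) : 1 ≤ (C.edges ∩ G.cotreeEdges f).card := by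
    obtain ⟨e, he, he'⟩ := hG.connected.exists_mem_cotreeEdges f (mem_cycleFinset.1 hC)
    exact Finset.card_pos.2 ⟨e, Finset.mem_inter.2 ⟨he, he'⟩⟩
  have hk : G.cycleFinset.card = (G.cotreeEdges f).card := by
    have := Fintype.ofFinite G.edgeSet
    have h1 := hG.card_edgeFinset_add_one
    have h2 := hG.connected.card_cotreeEdges hf
    rw [card_cycleFinset]
    lia
  have hdisj : (G.cycleFinset : Set G.Subgraph).PairwiseDisjoint
      fun C => C.edges ∩ G.cotreeEdges f := fun C hC D hD hne =>
    (hG.pairwiseDisjoint_edges hC hD hne).mono Finset.inter_subset_left Finset.inter_subset_left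
  have hsub : G.cycleFinset.biUnion (fun C => C.edges ∩ G.cotreeEdges f) ⊆ G.cotreeEdges f :=
    Finset.biUnion_subset.2 fun C _ => Finset.inter_subset_right
  have hle := Finset.card_le_card hsub
  have hcard := Finset.card_biUnion hdisj
  have hge := Finset.sum_le_sum hpos
  rw [Finset.sum_const, smul_eq_mul, mul_one] at hge
  constructor
  · intro C hC
    have heq : ∑ C ∈ G.cycleFinset, 1 = ∑ C ∈ G.cycleFinset, (C.edges ∩ G.cotreeEdges f).card := by
      rw [Finset.sum_const, smul_eq_mul, mul_one]
      lia
    exact ((Finset.sum_eq_sum_iff_of_le hpos).1 heq C (mem_cycleFinset.2 hC)).symm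
  · intro e he
    have := Finset.eq_of_subset_of_card_le hsub (by lia)
    rw [← this] at he
    obtain ⟨C, hC, he⟩ := Finset.mem_biUnion.1 he
    exact ⟨C, mem_cycleFinset.1 hC, (Finset.mem_inter.1 he).1⟩

lemma mem_cotreeEdges_of_isLevel (hG : G.IsCactus) {e f : Sym2 V} (he : e ∈ G.edgeSet)
    (hef : e ≠ f) (h : IsLevel (G.edgeVertDist f) e) : e ∈ G.cotreeEdges f :=
  mem_cotreeEdges.2 ⟨he, hef, fun hT => hG.connected.not_isLevel_of_mem_bfsEdges hT h⟩

/-- An edge on no cycle is level only with respect to itself. -/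
lemma eq_of_isLevel (hG : G.IsCactus) {e f : Sym2 V} (hf : f.IsDiag ∨ f ∈ G.edgeSet)
    (he : e ∈ G.edgeSet) (hcyc : ∀ C ∈ G.cycleSubgraphs, e ∉ C.edges)
    (h : IsLevel (G.edgeVertDist f) e) : e = f := by
  classical
  by_contra hef
  obtain ⟨C, hC, heC⟩ := (hG.card_cycle_inter_cotreeEdges hf).2 e
    (hG.mem_cotreeEdges_of_isLevel he hef h)
  exact hcyc C hC heC

/-- Level edges of `C` are cotree edges, so there is at most one; parity decides between 0 and 1. -/
lemma card_filter_isLevel_of_notMem (hG : G.IsCactus) {f : Sym2 V}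
    (hf : f.IsDiag ∨ f ∈ G.edgeSet) [DecidablePred (IsLevel (G.edgeVertDist f))] {C : G.Subgraph}
    (hC : C ∈ G.cycleSubgraphs) (hfC : f ∉ C.edges) :
    (C.edges.filter (IsLevel (G.edgeVertDist f))).card = C.edges.card % 2 := by
  classical
  have hsub : C.edges.filter (IsLevel (G.edgeVertDist f)) ⊆ C.edges ∩ G.cotreeEdges f := by
    intro e he
    rw [Finset.mem_filter] at he
    exact Finset.mem_inter.2 ⟨he.1, hG.mem_cotreeEdges_of_isLevel (Subgraph.edges_subset he.1)
      (fun h => hfC (h ▸ he.1)) he.2⟩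
  have hle := Finset.card_le_card hsub
  rw [(hG.card_cycle_inter_cotreeEdges hf).1 C hC] at hle
  have := card_filter_isLevel_mod_two (hG.connected.edgeVertDist_adj f) hC
  lia

/-- Now `f` itself is level and at most one cotree edge joins it; parity decides between 1 and 2. -/
lemma card_filter_isLevel_of_mem (hG : G.IsCactus) {f : Sym2 V}
    [DecidablePred (IsLevel (G.edgeVertDist f))] {C : G.Subgraph}
    (hC : C ∈ G.cycleSubgraphs) (hfC : f ∈ C.edges) :
    (C.edges.filter (IsLevel (G.edgeVertDist f))).card = 2 - C.edges.card % 2 := by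
  classical
  have hfE : f ∈ G.edgeSet := Subgraph.edges_subset hfC
  have hsub : C.edges.filter (IsLevel (G.edgeVertDist f)) ⊆
      insert f (C.edges ∩ G.cotreeEdges f) := by
    intro e he
    rw [Finset.mem_filter] at he
    rw [Finset.mem_insert, or_iff_not_imp_left]
    exact fun h => Finset.mem_inter.2 ⟨he.1, hG.mem_cotreeEdges_of_isLevel
      (Subgraph.edges_subset he.1) h he.2⟩
  have hle := (Finset.card_le_card hsub).trans (Finset.card_insert_le _ _)
  rw [(hG.card_cycle_inter_cotreeEdges (Or.inr hfE)).1 C hC] at hle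
  have hpos : 0 < (C.edges.filter (IsLevel (G.edgeVertDist f))).card :=
    Finset.card_pos.2 ⟨f, Finset.mem_filter.2 ⟨hfC, hG.connected.isLevel_self f⟩⟩
  have := card_filter_isLevel_mod_two (hG.connected.edgeVertDist_adj f) hC
  lia

end IsCactus

end SimpleGraph

namespace SimpleGraph

variable {V : Type*} {G : SimpleGraph V}

/-! ### The terms of the two indices -/

/-- The term of an edge in the edge Szeged index. -/
noncomputable def edgeSzegedTerm (G : SimpleGraph V) (e : Sym2 V) : ℕ :=
  Sym2.lift ⟨fun u v => G.edgeCloser u v * G.edgeCloser v u, fun _ _ => Nat.mul_comm _ _⟩ e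

/-- Twice the term of an edge in the edge-vertex Szeged index. -/
noncomputable def edgeVertexSzegedTerm (G : SimpleGraph V) (e : Sym2 V) : ℕ :=
  Sym2.lift ⟨fun u v => G.vertCloser u v * G.edgeCloser v u +
    G.vertCloser v u * G.edgeCloser u v, fun _ _ => Nat.add_comm _ _⟩ e

/-- The number of edges that are not equidistant from the two ends of `e`. -/
noncomputable def edgeCloserSum (G : SimpleGraph V) (e : Sym2 V) : ℕ :=
  Sym2.lift ⟨fun u v => G.edgeCloser u v + G.edgeCloser v u, fun _ _ => Nat.add_comm _ _⟩ e

/-- The number of vertices that are not equidistant from the two ends of `e`. -/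
noncomputable def vertCloserSum (G : SimpleGraph V) (e : Sym2 V) : ℕ :=
  Sym2.lift ⟨fun u v => G.vertCloser u v + G.vertCloser v u, fun _ _ => Nat.add_comm _ _⟩ e

/-- The excess of `edgeSzegedTerm` over `edgeCloserSum - 1`. -/
noncomputable def edgeExcess (G : SimpleGraph V) (e : Sym2 V) : ℤ :=
  Sym2.lift ⟨fun u v => ((G.edgeCloser u v : ℤ) - 1) * (G.edgeCloser v u - 1),
    fun _ _ => mul_comm _ _⟩ e

/-- The excess of `edgeVertexSzegedTerm` over `vertCloserSum + edgeCloserSum - 2`. -/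
noncomputable def edgeVertexExcess (G : SimpleGraph V) (e : Sym2 V) : ℤ :=
  Sym2.lift ⟨fun u v => ((G.vertCloser u v : ℤ) - 1) * (G.edgeCloser v u - 1) +
    ((G.vertCloser v u : ℤ) - 1) * (G.edgeCloser u v - 1), fun _ _ => add_comm _ _⟩ e

lemma edgeSzegedTerm_eq (e : Sym2 V) :
    (G.edgeSzegedTerm e : ℤ) = G.edgeExcess e + G.edgeCloserSum e - 1 := by
  induction e with | _ u v
  simp only [edgeSzegedTerm, edgeExcess, edgeCloserSum, Sym2.lift_mk]
  push_cast
  ring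

lemma edgeVertexSzegedTerm_eq (e : Sym2 V) :
    (G.edgeVertexSzegedTerm e : ℤ) =
      G.edgeVertexExcess e + G.vertCloserSum e + G.edgeCloserSum e - 2 := by
  induction e with | _ u v
  simp only [edgeVertexSzegedTerm, edgeVertexExcess, edgeCloserSum, vertCloserSum, Sym2.lift_mk]
  push_cast
  ring

lemma ncard_lt_add_ncard_lt_add_card_eq {α : Type*} (s : Finset α) (p q : α → ℕ) :
    {x | x ∈ s ∧ p x < q x}.ncard + {x | x ∈ s ∧ q x < p x}.ncard +
      (s.filter fun x => p x = q x).card = s.card := by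
  classical
  have h1 : {x | x ∈ s ∧ p x < q x} = (s.filter fun x => p x < q x : Set α) := by ext; simp
  have h2 : {x | x ∈ s ∧ q x < p x} = (s.filter fun x => q x < p x : Set α) := by ext; simp
  rw [h1, h2, Set.ncard_coe_finset, Set.ncard_coe_finset, ← Finset.card_union_of_disjoint,
    ← Finset.card_union_of_disjoint]
  · congr 1
    ext x
    simp only [Finset.mem_union, Finset.mem_filter]
    grind
  all_goals
    rw [Finset.disjoint_left]
    intro x
    simp only [Finset.mem_union, Finset.mem_filter]
    grind

open Classical in
lemma edgeCloserSum_add [Fintype G.edgeSet] (e : Sym2 V) :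
    G.edgeCloserSum e + (G.edgeFinset.filter fun f => IsLevel (G.edgeVertDist f) e).card =
      G.edgeFinset.card := by
  induction e with | _ u v
  rw [← ncard_lt_add_ncard_lt_add_card_eq G.edgeFinset (fun f => G.edgeVertDist f u)
    (fun f => G.edgeVertDist f v)]
  simp [edgeCloserSum, edgeCloser]

lemma Connected.edgeVertDist_lt (hG : G.Connected) {u v x : V} (huv : u ≠ v) (hx : x ≠ v) :
    G.edgeVertDist s(u, x) u < G.edgeVertDist s(u, x) v := by
  rw [hG.edgeVertDist_eq_zero_iff.2 (by simp), Nat.pos_iff_ne_zero, ne_eq,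
    hG.edgeVertDist_eq_zero_iff]
  simp [huv.symm, hx.symm]

variable [Fintype V]

open Classical in
lemma vertCloserSum_add (e : Sym2 V) :
    G.vertCloserSum e +
      (Finset.univ.filter fun w => IsLevel (G.edgeVertDist s(w, w)) e).card = Fintype.card V := by
  induction e with | _ u v
  rw [← Finset.card_univ, ← ncard_lt_add_ncard_lt_add_card_eq Finset.univ
    (fun w => G.dist u w) (fun w => G.dist v w)]
  simp [vertCloserSum, vertCloser, dist_comm]

lemma Connected.vertCloser_pos (hG : G.Connected) {u v : V} (h : u ≠ v) :
    0 < G.vertCloser u v := by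
  rw [vertCloser, Set.ncard_pos]
  exact ⟨u, by simpa using hG.pos_dist_of_ne h.symm⟩

/-- The edges at `u` other than `uv` are closer to `u`. -/
lemma Connected.edgeCloser_pos (hG : G.Connected) {u v x : V} (huv : u ≠ v) (hx : x ≠ v)
    (hux : G.Adj u x) : 0 < G.edgeCloser u v := by
  rw [edgeCloser, Set.ncard_pos]
  exact ⟨s(u, x), hux, hG.edgeVertDist_lt huv hx⟩

lemma edgeCloser_pos_of_mem_cycleSubgraphs (hG : G.Connected) {C : G.Subgraph}
    (hC : C ∈ G.cycleSubgraphs) {u v : V} (h : C.Adj u v) : 0 < G.edgeCloser u v := by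
  obtain ⟨x, hx, hux⟩ := exists_adj_ne_of_mem_cycleSubgraphs hC h
  exact hG.edgeCloser_pos h.ne hx hux.adj_sub

lemma edgeExcess_nonneg (hG : G.Connected) {C : G.Subgraph} (hC : C ∈ G.cycleSubgraphs)
    {e : Sym2 V} (he : e ∈ C.edges) : 0 ≤ G.edgeExcess e := by
  induction e with | _ u v
  have he : C.Adj u v := by simpa using he
  have h1 := edgeCloser_pos_of_mem_cycleSubgraphs hG hC he
  have h2 := edgeCloser_pos_of_mem_cycleSubgraphs hG hC he.symm
  exact mul_nonneg (by lia) (by lia)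

lemma edgeVertexExcess_nonneg (hG : G.Connected) {C : G.Subgraph} (hC : C ∈ G.cycleSubgraphs)
    {e : Sym2 V} (he : e ∈ C.edges) : 0 ≤ G.edgeVertexExcess e := by
  induction e with | _ u v
  have he : C.Adj u v := by simpa using he
  have h1 := edgeCloser_pos_of_mem_cycleSubgraphs hG hC he
  have h2 := edgeCloser_pos_of_mem_cycleSubgraphs hG hC he.symm
  have h3 := hG.vertCloser_pos he.ne
  have h4 := hG.vertCloser_pos he.ne.symm
  exact add_nonneg (mul_nonneg (by lia) (by lia)) (mul_nonneg (by lia) (by lia))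

/-! ### Sums over the edges of a cycle, and over all edges. -/

namespace IsCactus

lemma sum_vertCloserSum (hG : G.IsCactus) {C : G.Subgraph} (hC : C ∈ G.cycleSubgraphs) :
    ∑ e ∈ C.edges, G.vertCloserSum e + (if Even C.edges.card then 0 else Fintype.card V) =
      C.edges.card * Fintype.card V := by
  classical
  have hsum : ∑ e ∈ C.edges,
      (Finset.univ.filter fun w => IsLevel (G.edgeVertDist s(w, w)) e).card =
        ∑ w, (C.edges.filter (IsLevel (G.edgeVertDist s(w, w)))).card :=
    Finset.sum_card_bipartiteAbove_eq_sum_card_bipartiteBelow _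
  have hval : ∑ w, (C.edges.filter (IsLevel (G.edgeVertDist s(w, w)))).card =
      if Even C.edges.card then 0 else Fintype.card V := by
    have hterm (w : V) : (C.edges.filter (IsLevel (G.edgeVertDist s(w, w)))).card =
        if Even C.edges.card then 0 else 1 := by
      have hw : s(w, w) ∉ C.edges := fun h => (by simpa using h : C.Adj w w).ne rfl
      rw [hG.card_filter_isLevel_of_notMem (Or.inl (by simp)) hC hw]
      grind
    simp_rw [hterm]
    split_ifs <;> simp
  rw [← hval, ← hsum, ← Finset.sum_add_distrib,
    Finset.sum_congr rfl fun e _ => vertCloserSum_add e, Finset.sum_const, smul_eq_mul]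

variable [Fintype G.edgeSet]

/-- Double counting of pairs `(e, f)` with `e` on `C` level for `f`. On an odd cycle each `f` has
one such `e`; on an even cycle each `f` on `C` has two and the others none. -/
lemma sum_edgeCloserSum (hG : G.IsCactus) {C : G.Subgraph} (hC : C ∈ G.cycleSubgraphs) :
    ∑ e ∈ C.edges, G.edgeCloserSum e +
      (if Even C.edges.card then 2 * C.edges.card else G.edgeFinset.card) =
        C.edges.card * G.edgeFinset.card := by
  classical
  have hsum : ∑ e ∈ C.edges, (G.edgeFinset.filter fun f => IsLevel (G.edgeVertDist f) e).card =
      ∑ f ∈ G.edgeFinset, (C.edges.filter (IsLevel (G.edgeVertDist f))).card :=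
    Finset.sum_card_bipartiteAbove_eq_sum_card_bipartiteBelow _
  have hval : ∑ f ∈ G.edgeFinset, (C.edges.filter (IsLevel (G.edgeVertDist f))).card =
      if Even C.edges.card then 2 * C.edges.card else G.edgeFinset.card := by
    have hterm (f) (hf : f ∈ G.edgeFinset) :
        (C.edges.filter (IsLevel (G.edgeVertDist f))).card =
          if Even C.edges.card then (if f ∈ C.edges then 2 else 0) else 1 := by
      rw [mem_edgeFinset] at hf
      by_cases hfC : f ∈ C.edges
      · rw [hG.card_filter_isLevel_of_mem hC hfC]
        grind
      · rw [hG.card_filter_isLevel_of_notMem (Or.inr hf) hC hfC]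
        grind
    rw [Finset.sum_congr rfl hterm]
    split_ifs
    · have hsub : G.edgeFinset.filter (· ∈ C.edges) = C.edges := by
        ext e
        simp only [Finset.mem_filter, mem_edgeFinset, and_iff_right_iff_imp]
        exact Subgraph.edges_subset
      rw [← Finset.sum_filter, hsub, Finset.sum_const, smul_eq_mul, mul_comm]
    · simp
  rw [← hval, ← hsum, ← Finset.sum_add_distrib,
    Finset.sum_congr rfl fun e _ => edgeCloserSum_add e, Finset.sum_const, smul_eq_mul]

lemma card_le_card_edgeFinset (hG : G.IsCactus) {C : G.Subgraph} (hC : C ∈ G.cycleSubgraphs) :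
    Fintype.card V ≤ G.edgeFinset.card := by
  have h := hG.card_edgeFinset_add_one
  have : 0 < G.cycleSubgraphs.ncard := (Set.ncard_pos (Set.toFinite _)).2 ⟨C, hC⟩
  lia

lemma sum_edgeSzegedTerm_cycle (hG : G.IsCactus) (hn : 5 ≤ Fintype.card V) {C : G.Subgraph}
    (hC : C ∈ G.cycleSubgraphs) :
    (2 * G.edgeFinset.card - 3 : ℤ) ≤ ∑ e ∈ C.edges, (G.edgeSzegedTerm e : ℤ) ∧
      (∑ e ∈ C.edges, (G.edgeSzegedTerm e : ℤ) = 2 * G.edgeFinset.card - 3 ↔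
        C.edges.card = 3 ∧ ∀ e ∈ C.edges, G.edgeExcess e = 0) := by
  have hm := hn.trans (hG.card_le_card_edgeFinset hC)
  have h3 := three_le_card_edges_of_mem_cycleSubgraphs hC
  have hnn (e) (he : e ∈ C.edges) := edgeExcess_nonneg hG.connected hC he
  have hP := Finset.sum_nonneg hnn
  rw [← Finset.sum_eq_zero_iff_of_nonneg hnn]
  have hS := hG.sum_edgeCloserSum hC
  have hT : ∑ e ∈ C.edges, (G.edgeSzegedTerm e : ℤ) = ∑ e ∈ C.edges, G.edgeExcess e +
      (∑ e ∈ C.edges, G.edgeCloserSum e : ℕ) - C.edges.card := by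
    rw [Finset.sum_congr rfl fun e _ => edgeSzegedTerm_eq e, Finset.sum_sub_distrib,
      Finset.sum_add_distrib]
    simp
  rw [hT]
  generalize ∑ e ∈ C.edges, G.edgeExcess e = P at *
  generalize ∑ e ∈ C.edges, G.edgeCloserSum e = S at *
  generalize G.edgeFinset.card = m at *
  generalize C.edges.card = l at *
  split_ifs at hS with hl
  · have hl4 : 4 ≤ l := by grind
    zify at hS hl4 hm
    -- Here `S - l = l(m - 3)`. For `l = 4` the claim amounts to `2m > 9` when `P = 0`, which is
    -- where the order bound 5 matters: the 4-cycle violates the inequality.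
    have hlt : (2 * m - 3 : ℤ) < P + S - l := by
      nlinarith [mul_nonneg (sub_nonneg.2 hl4) (sub_nonneg.2 hm)]
    refine ⟨hlt.le, fun h => absurd h hlt.ne', ?_⟩
    rintro ⟨rfl, -⟩
    lia
  · rcases Nat.lt_or_ge 3 l with hl5 | hl5
    · zify at hS hl5 hm
      -- The difference of the two sides is `P + (l - 3)(m - 1)`.
      have hlt : (2 * m - 3 : ℤ) < P + S - l := by
        nlinarith [mul_pos (sub_pos.2 hl5) (show (0 : ℤ) < m - 1 by lia)]
      refine ⟨hlt.le, fun h => absurd h hlt.ne', ?_⟩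
      rintro ⟨rfl, -⟩
      lia
    · obtain rfl : l = 3 := by lia
      refine ⟨by lia, fun h => ⟨rfl, by lia⟩, fun h => by lia⟩

/-- Subtracting `m - 1` from every term makes 0 the sharp lower bound for edges on no cycle, so that
`sum_edgeFinset_bound` applies to this index too. -/
lemma sum_edgeVertexSzegedTerm_cycle (hG : G.IsCactus) (hn : 5 ≤ Fintype.card V)
    {C : G.Subgraph} (hC : C ∈ G.cycleSubgraphs) :
    (2 * Fintype.card V - G.edgeFinset.card - 3 : ℤ) ≤
      ∑ e ∈ C.edges, ((G.edgeVertexSzegedTerm e : ℤ) - (G.edgeFinset.card - 1)) ∧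
      (∑ e ∈ C.edges, ((G.edgeVertexSzegedTerm e : ℤ) - (G.edgeFinset.card - 1)) =
        2 * Fintype.card V - G.edgeFinset.card - 3 ↔
        C.edges.card = 3 ∧ ∀ e ∈ C.edges, G.edgeVertexExcess e = 0) := by
  have hm := hn.trans (hG.card_le_card_edgeFinset hC)
  have h3 := three_le_card_edges_of_mem_cycleSubgraphs hC
  have hnn (e) (he : e ∈ C.edges) := edgeVertexExcess_nonneg hG.connected hC he
  have hP := Finset.sum_nonneg hnn
  rw [← Finset.sum_eq_zero_iff_of_nonneg hnn]
  have hS := hG.sum_edgeCloserSum hC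
  have hS' := hG.sum_vertCloserSum hC
  have hT : ∑ e ∈ C.edges, ((G.edgeVertexSzegedTerm e : ℤ) - (G.edgeFinset.card - 1)) =
      ∑ e ∈ C.edges, G.edgeVertexExcess e + (∑ e ∈ C.edges, G.vertCloserSum e : ℕ) +
      (∑ e ∈ C.edges, G.edgeCloserSum e : ℕ) - C.edges.card * (G.edgeFinset.card + 1) := by
    rw [Finset.sum_sub_distrib, Finset.sum_congr rfl fun e _ => edgeVertexSzegedTerm_eq e,
      Finset.sum_sub_distrib, Finset.sum_add_distrib, Finset.sum_add_distrib]
    simp only [Finset.sum_const, nsmul_eq_mul]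
    push_cast
    ring
  rw [hT]
  generalize ∑ e ∈ C.edges, G.edgeVertexExcess e = P at *
  generalize ∑ e ∈ C.edges, G.edgeCloserSum e = S at *
  generalize ∑ e ∈ C.edges, G.vertCloserSum e = S' at *
  generalize G.edgeFinset.card = m at *
  generalize Fintype.card V = n at *
  generalize C.edges.card = l at *
  split_ifs at hS hS' with hl
  · have hl4 : 4 ≤ l := by grind
    zify at hS hS' hl4 hm hn
    have hlt : (2 * n - m - 3 : ℤ) < P + S' + S - l * (m + 1) := by
      nlinarith [mul_nonneg (sub_nonneg.2 hl4) (sub_nonneg.2 hn)]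
    refine ⟨hlt.le, fun h => absurd h hlt.ne', ?_⟩
    rintro ⟨rfl, -⟩
    lia
  · rcases Nat.lt_or_ge 3 l with hl5 | hl5
    · have hl5 : 5 ≤ l := by grind
      zify at hS hS' hl5 hm hn
      have hlt : (2 * n - m - 3 : ℤ) < P + S' + S - l * (m + 1) := by
        nlinarith [mul_nonneg (sub_nonneg.2 hl5) (sub_nonneg.2 hn)]
      refine ⟨hlt.le, fun h => absurd h hlt.ne', ?_⟩
      rintro ⟨rfl, -⟩
      lia
    · obtain rfl : l = 3 := by lia
      refine ⟨by lia, fun h => ⟨rfl, by lia⟩, fun h => by lia⟩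

/-- An edge on no cycle is the only edge equidistant from its two ends. -/
lemma edgeCloserSum_of_notMem_cycle (hG : G.IsCactus) {e : Sym2 V} (he : e ∈ G.edgeSet)
    (hcyc : ∀ C ∈ G.cycleSubgraphs, e ∉ C.edges) :
    G.edgeCloserSum e + 1 = G.edgeFinset.card := by
  classical
  rw [← edgeCloserSum_add e, add_right_inj, eq_comm, Finset.card_eq_one]
  refine ⟨e, ?_⟩
  ext f
  simp only [Finset.mem_filter, mem_edgeFinset, Finset.mem_singleton]
  refine ⟨fun h => (hG.eq_of_isLevel (Or.inr h.1) he hcyc h.2).symm, ?_⟩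
  rintro rfl
  exact ⟨he, hG.connected.isLevel_self f⟩

lemma edgeVertexSzegedTerm_of_notMem_cycle (hG : G.IsCactus) {u v : V} (he : G.Adj u v)
    (hcyc : ∀ C ∈ G.cycleSubgraphs, s(u, v) ∉ C.edges) :
    (G.edgeVertexSzegedTerm s(u, v) : ℤ) - (G.edgeFinset.card - 1) =
      (G.vertCloser u v - 1) * G.edgeCloser v u + (G.vertCloser v u - 1) * G.edgeCloser u v := by
  have h := hG.edgeCloserSum_of_notMem_cycle (e := s(u, v)) he hcyc
  simp only [edgeCloserSum, edgeVertexSzegedTerm, Sym2.lift_mk] at h ⊢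
  rw [← h]
  push_cast
  ring

/-- The cycles of a cactus are edge-disjoint, so the sum splits into one part per cycle and the
edges on no cycle; equality holds exactly when it holds in every part. -/
lemma sum_edgeFinset_bound (hG : G.IsCactus) (F : Sym2 V → ℤ) (b : ℤ)
    (h0 : ∀ e ∈ G.edgeSet, (∀ C ∈ G.cycleSubgraphs, e ∉ C.edges) → 0 ≤ F e)
    (hb : ∀ C ∈ G.cycleSubgraphs, b ≤ ∑ e ∈ C.edges, F e) :
    G.cycleSubgraphs.ncard * b ≤ ∑ e ∈ G.edgeFinset, F e ∧
      (∑ e ∈ G.edgeFinset, F e = G.cycleSubgraphs.ncard * b ↔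
        (∀ e ∈ G.edgeSet, (∀ C ∈ G.cycleSubgraphs, e ∉ C.edges) → F e = 0) ∧
          ∀ C ∈ G.cycleSubgraphs, ∑ e ∈ C.edges, F e = b) := by
  classical
  set U := G.cycleFinset.biUnion Subgraph.edges
  have hU : U ⊆ G.edgeFinset := by
    intro e he
    obtain ⟨C, -, he⟩ := Finset.mem_biUnion.1 he
    simpa using Subgraph.edges_subset he
  have hmem (e : Sym2 V) : e ∈ G.edgeFinset \ U ↔
      e ∈ G.edgeSet ∧ ∀ C ∈ G.cycleSubgraphs, e ∉ C.edges := by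
    simp [U]
  have hsplit : ∑ e ∈ G.edgeFinset, F e =
      ∑ e ∈ G.edgeFinset \ U, F e + ∑ C ∈ G.cycleFinset, ∑ e ∈ C.edges, F e := by
    rw [← Finset.sum_biUnion hG.pairwiseDisjoint_edges, Finset.sum_sdiff hU]
  have hnn (e) (he : e ∈ G.edgeFinset \ U) : 0 ≤ F e := h0 e ((hmem e).1 he).1 ((hmem e).1 he).2
  have hb' (C) (hC : C ∈ G.cycleFinset) : b ≤ ∑ e ∈ C.edges, F e := hb C (mem_cycleFinset.1 hC)
  have h1 := Finset.sum_nonneg hnn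
  have h2 := Finset.sum_le_sum hb'
  have hconst : ∑ C ∈ G.cycleFinset, b = G.cycleSubgraphs.ncard * b := by
    rw [Finset.sum_const, card_cycleFinset, nsmul_eq_mul]
  rw [hsplit]
  refine ⟨by lia, ?_⟩
  trans (∑ e ∈ G.edgeFinset \ U, F e = 0 ∧
    ∑ C ∈ G.cycleFinset, b = ∑ C ∈ G.cycleFinset, ∑ e ∈ C.edges, F e)
  · constructor
    · intro h
      constructor <;> lia
    · rintro ⟨h, h'⟩
      lia
  · rw [Finset.sum_eq_zero_iff_of_nonneg hnn, Finset.sum_eq_sum_iff_of_le hb']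
    simp only [hmem, mem_cycleFinset, and_imp, eq_comm (a := b)]

end IsCactus

end SimpleGraph

namespace SimpleGraph

variable {V : Type*} {G : SimpleGraph V}

/-! ### Graphs with a universal vertex -/

/-- A connected graph in which the closed neighbourhoods of any two adjacent vertices are nested has
a universal vertex. -/
lemma Connected.exists_universal [Finite V] (hG : G.Connected)
    (h : ∀ u v, G.Adj u v →
      (∀ x, G.Adj u x → x ≠ v → G.Adj v x) ∨ (∀ x, G.Adj v x → x ≠ u → G.Adj u x)) :
    ∃ c, ∀ x, x ≠ c → G.Adj c x := by
  classical
  have := Fintype.ofFinite V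
  have := hG.nonempty
  obtain ⟨c, -, hc⟩ := Finset.exists_max_image Finset.univ (fun v => G.degree v)
    Finset.univ_nonempty
  refine ⟨c, ?_⟩
  by_contra! hcon
  obtain ⟨y, hy, hcy⟩ := hcon
  obtain ⟨p⟩ := hG.preconnected c y
  obtain ⟨d, -, hd1, hd2⟩ := p.exists_boundary_dart {x | x = c ∨ G.Adj c x} (by simp)
    (by simp [hy, hcy])
  simp only [Set.mem_ofPred_eq, not_or] at hd1 hd2
  have hadj := d.adj
  have hcx : G.Adj c d.fst := hd1.resolve_left fun h' => hd2.2 (h' ▸ hadj)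
  -- `d` leaves the closed neighbourhood of `c`, a vertex of maximum degree. Nesting would either
  -- give `d.fst` a larger degree than `c` or make `d.snd` a neighbour of `c`.
  rcases h c d.fst hcx with h1 | h1
  · have hlt : G.degree c < G.degree d.fst := by
      rw [← card_neighborFinset_eq_degree, ← card_neighborFinset_eq_degree,
        ← Finset.card_erase_add_one (a := d.fst) (by simpa using hcx), Nat.lt_iff_add_one_le]
      have hsub : insert d.snd (insert c ((G.neighborFinset c).erase d.fst)) ⊆
          G.neighborFinset d.fst := by
        intro x
        simp only [Finset.mem_insert, Finset.mem_erase, mem_neighborFinset]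
        rintro (rfl | rfl | ⟨hx, hx'⟩)
        · exact hadj
        · exact hcx.symm
        · exact h1 x hx' hx
      have hle := Finset.card_le_card hsub
      rwa [Finset.card_insert_of_notMem (by simp [hd2.1, hd2.2]),
        Finset.card_insert_of_notMem (by simp)] at hle
    exact absurd (hc d.fst (Finset.mem_univ _)) (by simpa using hlt)
  · exact hd2.2 (h1 d.snd hadj hd2.1)

lemma nested_of_edgeCloser_eq_zero [Fintype V] (hG : G.Connected) {u v : V} (huv : u ≠ v)
    (h : G.edgeCloser u v = 0) (x : V) (hux : G.Adj u x) (hx : x ≠ v) : G.Adj v x :=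
  absurd h (hG.edgeCloser_pos huv hx hux).ne'

/-- The triangle edge `uz` is already closer to `u`, as would be any other edge at `u` except `uv`.
So `u` has only the neighbours `v` and `z`. -/
lemma nested_of_edgeCloser_eq_one [Fintype V] (hG : G.Connected) {C : G.Subgraph}
    (hC : C ∈ G.cycleSubgraphs) (h3 : C.edges.card = 3) {u v : V} (huv : C.Adj u v)
    (h : G.edgeCloser u v = 1) (x : V) (hux : G.Adj u x) (hx : x ≠ v) : G.Adj v x := by
  obtain ⟨z, hz, huz⟩ := exists_adj_ne_of_mem_cycleSubgraphs hC huv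
  obtain ⟨f, hf⟩ := Set.ncard_eq_one.1 h
  have h1 : s(u, x) ∈ ({f} : Set (Sym2 V)) := by
    rw [← hf]
    exact ⟨hux, hG.edgeVertDist_lt huv.ne hx⟩
  have h2 : s(u, z) ∈ ({f} : Set (Sym2 V)) := by
    rw [← hf]
    exact ⟨huz.adj_sub, hG.edgeVertDist_lt huv.ne hz⟩
  obtain rfl : x = z := Sym2.congr_right.1 (h1.trans h2.symm)
  exact (adj_of_card_edges_eq_three hC h3 huv hz huz).adj_sub

lemma nested_of_vertCloser_eq_one [Fintype V] (hG : G.Connected) {u v : V} (huv : u ≠ v)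
    (h : G.vertCloser u v = 1) (x : V) (hux : G.Adj u x) (hx : x ≠ v) : G.Adj v x := by
  obtain ⟨w, hw⟩ := Set.ncard_eq_one.1 h
  have h1 : u ∈ ({w} : Set V) := by
    rw [← hw]
    simpa using hG.pos_dist_of_ne huv.symm
  have h2 : x ∉ ({w} : Set V) := fun h2 => hux.ne (h1.trans h2.symm)
  rw [← hw] at h2
  simp only [Set.mem_ofPred_eq, not_lt, dist_eq_one_iff_adj.2 hux] at h2
  have := hG.pos_dist_of_ne hx.symm
  exact dist_eq_one_iff_adj.1 (by lia)

namespace IsCactus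

/-- Otherwise the triangles `cxy` and `cxz` would share the edge `cx`. Thus deleting `c` leaves
isolated edges and vertices. -/
lemma eq_of_universal (hG : G.IsCactus) {c : V} (hc : ∀ x, x ≠ c → G.Adj c x) {x y z : V}
    (hx : x ≠ c) (hy : y ≠ c) (hz : z ≠ c) (hxy : G.Adj x y) (hxz : G.Adj x z) : y = z := by
  obtain ⟨C, hC, hC1, -, -, hCv⟩ := exists_cycle_of_triangle (hc x hx) hxy (hc y hy).symm
  obtain ⟨D, hD, hD1, -, -, hDv⟩ := exists_cycle_of_triangle (hc x hx) hxz (hc z hz).symm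
  obtain rfl := hG.eq_of_adj hC hD hC1 hD1
  have h : y ∈ C.verts := by simp [hCv]
  rw [hDv] at h
  have := hxy.ne
  grind

end IsCactus

/-! ### Distances and closeness counts around a universal vertex. -/

section Universal

variable {c : V}

lemma dist_le_one_of_universal (hc : ∀ x, x ≠ c → G.Adj c x) (w : V) : G.dist w c ≤ 1 := by
  by_cases h : w = c
  · simp [h]
  · exact (dist_eq_one_iff_adj.2 (hc w h).symm).le

lemma dist_le_two_of_universal (hG : G.Connected) (hc : ∀ x, x ≠ c → G.Adj c x) (w x : V) :
    G.dist w x ≤ 2 := by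
  have h1 := dist_le_one_of_universal hc w
  have h2 := dist_le_one_of_universal hc x
  have h3 := hG.dist_triangle (u := w) (v := c) (w := x)
  rw [dist_comm (u := c)] at h3
  lia

lemma edgeVertDist_le_one_of_universal (hc : ∀ x, x ≠ c → G.Adj c x) (f : Sym2 V) :
    G.edgeVertDist f c ≤ 1 := by
  induction f with | _ a b
  exact (min_le_left _ _).trans (dist_le_one_of_universal hc a)

lemma edgeVertDist_le_two_of_universal (hG : G.Connected) (hc : ∀ x, x ≠ c → G.Adj c x)
    (f : Sym2 V) (x : V) : G.edgeVertDist f x ≤ 2 := by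
  induction f with | _ a b
  exact (min_le_left _ _).trans (dist_le_two_of_universal hG hc a x)

lemma mem_cotreeEdges_of_universal [Fintype V] (hG : G.Connected) (hc : ∀ x, x ≠ c → G.Adj c x)
    {e : Sym2 V} : e ∈ G.cotreeEdges s(c, c) ↔ e ∈ G.edgeSet ∧ c ∉ e := by
  have hpar (v : V) (hv : v ∉ s(c, c)) : G.bfsParent s(c, c) v = c := by
    have h1 := hG.edgeVertDist_bfsParent_lt hv
    have h2 : G.edgeVertDist s(c, c) v ≤ 1 := by
      simpa [dist_comm] using dist_le_one_of_universal hc v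
    simpa using (hG.edgeVertDist_eq_zero_iff (f := s(c, c))).1 (by lia)
  rw [mem_cotreeEdges]
  refine and_congr_right fun he => ⟨fun h hce => h.2 ?_, fun h => ⟨?_, fun hT => ?_⟩⟩
  · obtain ⟨x, rfl⟩ := hce
    have hx : x ∉ s(c, c) := by simpa using (G.ne_of_adj he).symm
    exact mem_bfsEdges.2 ⟨x, hx, by rw [hpar x hx, Sym2.eq_swap]⟩
  · rintro rfl
    simp at h
  · obtain ⟨v, hv, rfl⟩ := mem_bfsEdges.1 hT
    simp [hpar v hv] at h

/-- Every edge is within distance 1 of `c`, so being strictly closer to `x` leaves only the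
distances 0 and 1. -/
lemma mem_of_edgeVertDist_lt_of_universal (hG : G.Connected) (hc : ∀ x, x ≠ c → G.Adj c x)
    {f : Sym2 V} {x : V} (h : G.edgeVertDist f x < G.edgeVertDist f c) : x ∈ f ∧ c ∉ f := by
  have h1 := edgeVertDist_le_one_of_universal hc f
  constructor
  · exact hG.edgeVertDist_eq_zero_iff.1 (by lia)
  · intro hcf
    rw [hG.edgeVertDist_eq_zero_iff.2 hcf] at h
    lia

lemma vertCloser_center (hG : G.Connected) (hc : ∀ x, x ≠ c → G.Adj c x) {x : V} (hx : x ≠ c) :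
    G.vertCloser x c = 1 := by
  rw [vertCloser, Set.ncard_eq_one]
  refine ⟨x, ?_⟩
  ext w
  simp only [Set.mem_ofPred_eq, Set.mem_singleton_iff]
  constructor
  · intro h
    have h1 := dist_le_one_of_universal hc w
    rw [dist_comm] at h1
    exact (hG.dist_eq_zero_iff.1 (by lia)).symm
  · rintro rfl
    simpa using hG.pos_dist_of_ne hx.symm

lemma edgeCloser_center_eq_zero (hG : G.Connected) (hc : ∀ x, x ≠ c → G.Adj c x) {x : V}
    (hx : ∀ y, G.Adj x y → y = c) : G.edgeCloser x c = 0 := by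
  have h0 : {f : Sym2 V | f ∈ G.edgeSet ∧ G.edgeVertDist f x < G.edgeVertDist f c} = ∅ := by
    ext f
    simp only [Set.mem_ofPred_eq, Set.mem_empty_iff_false, iff_false, not_and]
    intro hf h
    obtain ⟨⟨y, rfl⟩, hcf⟩ := mem_of_edgeVertDist_lt_of_universal hG hc h
    rw [hx y hf] at hcf
    simp at hcf
  rw [edgeCloser, h0, Set.ncard_empty]

lemma edgeCloser_center_eq_one (hG : G.IsCactus) (hc : ∀ x, x ≠ c → G.Adj c x) {x y : V}
    (hx : x ≠ c) (hy : y ≠ c) (hxy : G.Adj x y) : G.edgeCloser x c = 1 := by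
  rw [edgeCloser, Set.ncard_eq_one]
  refine ⟨s(x, y), ?_⟩
  ext f
  simp only [Set.mem_ofPred_eq, Set.mem_singleton_iff]
  constructor
  · rintro ⟨hf, h⟩
    obtain ⟨⟨z, rfl⟩, hcf⟩ := mem_of_edgeVertDist_lt_of_universal hG.connected hc h
    simp only [Sym2.mem_iff, not_or] at hcf
    rw [hG.eq_of_universal hc hx (Ne.symm hcf.2) hy hf hxy]
  · rintro rfl
    exact ⟨hxy, hG.connected.edgeVertDist_lt hx hy⟩

lemma vertCloser_petal (hG : G.IsCactus) (hc : ∀ x, x ≠ c → G.Adj c x) {x y : V}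
    (hx : x ≠ c) (hy : y ≠ c) (hxy : G.Adj x y) : G.vertCloser x y = 1 := by
  rw [vertCloser, Set.ncard_eq_one]
  refine ⟨x, ?_⟩
  ext w
  simp only [Set.mem_ofPred_eq, Set.mem_singleton_iff]
  constructor
  · intro h
    have h2 := dist_le_two_of_universal hG.connected hc y w
    by_contra hwx
    have hpos := hG.connected.pos_dist_of_ne (Ne.symm hwx)
    have hxw : G.Adj x w := dist_eq_one_iff_adj.1 (by lia)
    by_cases hwc : w = c
    · subst hwc
      have := dist_le_one_of_universal hc y
      lia
    · obtain rfl := hG.eq_of_universal hc hx hwc hy hxw hxy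
      simp at h
  · rintro rfl
    simpa using hG.connected.pos_dist_of_ne hxy.ne.symm

lemma edgeCloser_petal (hG : G.IsCactus) (hc : ∀ x, x ≠ c → G.Adj c x) {x y : V}
    (hx : x ≠ c) (hy : y ≠ c) (hxy : G.Adj x y) : G.edgeCloser x y = 1 := by
  have hconn := hG.connected
  rw [edgeCloser, Set.ncard_eq_one]
  refine ⟨s(x, c), ?_⟩
  ext f
  simp only [Set.mem_ofPred_eq, Set.mem_singleton_iff]
  constructor
  · rintro ⟨hf, h⟩
    have hyf : y ∉ f := fun hyf => by
      rw [hconn.edgeVertDist_eq_zero_iff.2 hyf] at h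
      lia
    by_cases hcf : c ∈ f
    · obtain ⟨b, rfl⟩ := hcf
      have h1 : G.edgeVertDist s(c, b) y ≤ 1 :=
        (min_le_left _ _).trans (by rw [dist_comm]; exact dist_le_one_of_universal hc y)
      have hxf := hconn.edgeVertDist_eq_zero_iff.1 (show G.edgeVertDist s(c, b) x = 0 by lia)
      rw [Sym2.mem_iff, or_iff_right hx] at hxf
      rw [hxf, Sym2.eq_swap]
    · exfalso
      -- The only neighbours of `x` are `c` and `y`, both off `f`. Hence `f` is at distance at least
      -- 2 from `x`, while no edge is farther than 2 from `y`.
      have hno (a : V) (ha : a ∈ f) (hxa : G.Adj x a) : False := by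
        have hac : a ≠ c := fun h => hcf (h ▸ ha)
        exact hyf (hG.eq_of_universal hc hx hac hy hxa hxy ▸ ha)
      have h2 := edgeVertDist_le_two_of_universal hconn hc f y
      by_cases hxf : x ∈ f
      · obtain ⟨b, rfl⟩ := hxf
        exact hno b (by simp) hf
      · induction f with | _ a b
        simp only [Sym2.mem_iff, not_or] at hxf
        have ha := hconn.pos_dist_of_ne (Ne.symm hxf.1)
        have hb := hconn.pos_dist_of_ne (Ne.symm hxf.2)
        have hm : min (G.dist a x) (G.dist b x) < 2 := h.trans_le h2
        rcases min_lt_iff.1 hm with h | h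
        · exact hno a (by simp) (dist_eq_one_iff_adj.1 (by lia : G.dist a x = 1)).symm
        · exact hno b (by simp) (dist_eq_one_iff_adj.1 (by lia : G.dist b x = 1)).symm
  · rintro rfl
    exact ⟨(hc x hx).symm, hconn.edgeVertDist_lt hxy.ne (Ne.symm hy)⟩

lemma eq_center_of_notMem_cycle (hc : ∀ x, x ≠ c → G.Adj c x) {u v : V} (he : G.Adj u v)
    (hcyc : ∀ C ∈ G.cycleSubgraphs, ¬ C.Adj u v) : u = c ∨ v = c := by
  by_contra! h
  obtain ⟨C, hC, -, hC', -, -⟩ := exists_cycle_of_triangle (hc u h.1) he (hc v h.2).symm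
  exact hcyc C hC hC'

lemma eq_center_of_adj_of_notMem_cycle (hc : ∀ x, x ≠ c → G.Adj c x) {x : V} (hx : x ≠ c)
    (hcyc : ∀ C ∈ G.cycleSubgraphs, ¬ C.Adj c x) (y : V) (hxy : G.Adj x y) : y = c := by
  by_contra h
  obtain ⟨C, hC, hC', -, -, -⟩ := exists_cycle_of_triangle (hc x hx) hxy (hc y h).symm
  exact hcyc C hC hC'

variable [Fintype V]

/-- In a cactus with a universal vertex `c`, every cycle is a triangle through `c`. -/
lemma IsCactus.cycle_of_universal (hG : G.IsCactus) (hc : ∀ x, x ≠ c → G.Adj c x)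
    {C : G.Subgraph} (hC : C ∈ G.cycleSubgraphs) :
    ∃ x y, x ≠ c ∧ y ≠ c ∧ G.Adj x y ∧ C.edges.card = 3 ∧
      ∀ e ∈ C.edges, e = s(c, x) ∨ e = s(c, y) ∨ e = s(x, y) := by
  classical
  -- The cotree edge of `C` misses `c`, so it spans a triangle with `c`; sharing an edge with `C`,
  -- that triangle is `C`.
  obtain ⟨e, heC, he⟩ := hG.connected.exists_mem_cotreeEdges s(c, c) hC
  obtain ⟨heE, hce⟩ := (mem_cotreeEdges_of_universal hG.connected hc).1 he
  induction e with | _ x y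
  simp only [Sym2.mem_iff, not_or] at hce
  have heC : C.Adj x y := by simpa using heC
  have hxy := heC.adj_sub
  obtain ⟨D, hD, -, hD', -, hDv⟩ :=
    exists_cycle_of_triangle (hc x (Ne.symm hce.1)) hxy (hc y (Ne.symm hce.2)).symm
  obtain rfl := hG.eq_of_adj hC hD heC hD'
  have hsub : ∀ e ∈ C.edges, e = s(c, x) ∨ e = s(c, y) ∨ e = s(x, y) := by
    intro e he
    induction e with | _ a b
    have he : C.Adj a b := by simpa using he
    have ha := he.fst_mem
    have hb := he.snd_mem
    have := he.ne
    rw [hDv] at ha hb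
    simp only [Set.mem_insert_iff, Set.mem_singleton_iff] at ha hb
    simp only [Sym2.eq_iff]
    grind
  refine ⟨x, y, Ne.symm hce.1, Ne.symm hce.2, hxy, le_antisymm ?_
    (three_le_card_edges_of_mem_cycleSubgraphs hC), hsub⟩
  have hsub' : C.edges ⊆ {s(c, x), s(c, y), s(x, y)} := fun e he => by simpa using hsub e he
  exact (Finset.card_le_card hsub').trans Finset.card_le_three

end Universal

/-! ### The extremal graph -/

lemma triangleBundle_adj_none {k p : ℕ} {x} (hx : x ≠ none) : (triangleBundle k p).Adj none x := by
  rw [triangleBundle, fromRel_adj]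
  exact ⟨hx.symm, Or.inl (Or.inl rfl)⟩

lemma exists_universal_of_iso {k p : ℕ} (φ : G ≃g triangleBundle k p) :
    ∃ c, ∀ x, x ≠ c → G.Adj c x := by
  refine ⟨φ.symm none, fun x hx => ?_⟩
  rw [← φ.map_adj_iff, φ.apply_symm_apply]
  exact triangleBundle_adj_none fun h => hx (by rw [← h, φ.symm_apply_apply])

/-- A cactus with a universal vertex is a bundle of triangles and pendant edges. -/
lemma IsCactus.exists_iso_triangleBundle [Fintype V] (hG : G.IsCactus) {c : V}
    (hc : ∀ x, x ≠ c → G.Adj c x) :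
    ∃ p, Nonempty (G ≃g triangleBundle G.cycleSubgraphs.ncard p) := by
  classical
  have hk : (G.cotreeEdges s(c, c)).card = G.cycleSubgraphs.ncard := by
    have := Fintype.ofFinite G.edgeSet
    have h1 := hG.card_edgeFinset_add_one
    have h2 := hG.connected.card_cotreeEdges (f := s(c, c)) (Or.inl (by simp))
    lia
  generalize G.cycleSubgraphs.ncard = k at hk ⊢
  -- The edges missing `c` index the triangles; `U` below collects the ends of the pendant edges.
  let ε : Fin k ≃ G.cotreeEdges s(c, c) := (Finset.equivFinOfCardEq hk).symm
  have hex (i : Fin k) : ∃ a b, (ε i : Sym2 V) = s(a, b) := by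
    induction h : (ε i : Sym2 V) with | _ a b
    exact ⟨a, b, rfl⟩
  choose A B hAB using hex
  have hmem (i : Fin k) : G.Adj (A i) (B i) ∧ A i ≠ c ∧ B i ≠ c := by
    have h := (mem_cotreeEdges_of_universal hG.connected hc).1 (ε i).2
    rw [hAB i] at h
    simp only [mem_edgeSet, Sym2.mem_iff, not_or] at h
    exact ⟨h.1, Ne.symm h.2.1, Ne.symm h.2.2⟩
  let U : Finset V := Finset.univ.filter fun x => x ≠ c ∧ ∀ y, G.Adj x y → y = c
  let η : Fin U.card ≃ U := U.equivFin.symm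
  have hU (j : Fin U.card) : (η j : V) ≠ c ∧ ∀ y, G.Adj (η j) y → y = c :=
    (Finset.mem_filter.1 (η j).2).2
  let P : Fin k × Bool → V := fun q => if q.2 then B q.1 else A q.1
  have hPc (q) : P q ≠ c := by
    rcases q with ⟨i, _ | _⟩ <;> simp [P, hmem i]
  have hPadj (i : Fin k) (b : Bool) : G.Adj (P (i, b)) (P (i, !b)) := by
    cases b
    · exact (hmem i).1
    · exact (hmem i).1.symm
  have hPe (i : Fin k) (b : Bool) : (ε i : Sym2 V) = s(P (i, b), P (i, !b)) := by
    cases b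
    · exact hAB i
    · exact (hAB i).trans Sym2.eq_swap
  have hPinj : Function.Injective P := by
    rintro ⟨i, b⟩ ⟨j, b'⟩ h
    have hji : P (i, !b) = P (j, !b') :=
      hG.eq_of_universal hc (hPc _) (hPc _) (hPc _) (hPadj i b) (h ▸ hPadj j b')
    have hij : i = j := by
      apply ε.injective
      ext1
      rw [hPe i b, hPe j b', h, hji]
    subst hij
    by_cases hb : b = b'
    · rw [hb]
    · have hb' : b' = !b := by cases b <;> cases b' <;> simp_all
      exact absurd (hb' ▸ h) (hPadj i b).ne
  let ψ : Option ((Fin k × Bool) ⊕ Fin U.card) → V :=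
    fun o => o.elim c (Sum.elim P fun j => η j)
  have hψ : Function.Bijective ψ := by
    constructor
    · rintro (_ | q | j) (_ | q' | j') h
      · rfl
      · exact absurd h.symm (hPc q')
      · exact absurd h.symm (hU j').1
      · exact absurd h (hPc q)
      · rw [hPinj h]
      · have h : P q = η j' := h
        exact absurd ((hU j').2 _ (h ▸ hPadj q.1 q.2)) (hPc _)
      · exact absurd h (hU j).1
      · have h : η j = P q' := h
        exact absurd ((hU j).2 _ (h ▸ hPadj q'.1 q'.2)) (hPc _)
      · have h : (η j : V) = η j' := h
        rw [η.injective (Subtype.ext h)]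
    · intro x
      by_cases hx : x = c
      · exact ⟨none, hx.symm⟩
      · by_cases hxU : ∀ y, G.Adj x y → y = c
        · have hxm : x ∈ U := by simpa [U] using ⟨hx, hxU⟩
          exact ⟨some (.inr (η.symm ⟨x, hxm⟩)), by simp [ψ]⟩
        · push Not at hxU
          obtain ⟨y, hxy, hy⟩ := hxU
          have hm : s(x, y) ∈ G.cotreeEdges s(c, c) :=
            (mem_cotreeEdges_of_universal hG.connected hc).2
              ⟨hxy, by simp [Ne.symm hx, Ne.symm hy]⟩
          have hi := hAB (ε.symm ⟨s(x, y), hm⟩)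
          rw [Equiv.apply_symm_apply] at hi
          rcases Sym2.eq_iff.1 hi with ⟨h, -⟩ | ⟨h, -⟩
          · exact ⟨some (.inl (_, false)), h.symm⟩
          · exact ⟨some (.inl (_, true)), h.symm⟩
  have hadjP (q q') : G.Adj (P q) (P q') ↔ q.1 = q'.1 ∧ q.2 ≠ q'.2 := by
    obtain ⟨i, b⟩ := q
    obtain ⟨j, b'⟩ := q'
    constructor
    · intro h
      have := hPinj (hG.eq_of_universal hc (hPc _) (hPc _) (hPc _) h (hPadj i b))
      grind
    · rintro ⟨rfl, hb⟩
      have hb' : b' = !b := by cases b <;> cases b' <;> simp_all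
      exact hb' ▸ hPadj i b
  refine ⟨U.card, ⟨RelIso.symm ⟨Equiv.ofBijective ψ hψ, ?_⟩⟩⟩
  intro o o'
  rw [Equiv.ofBijective_apply, Equiv.ofBijective_apply]
  rcases o with _ | q | j <;> rcases o' with _ | q' | j'
  · simp
  · exact iff_of_true (hc _ (hPc q')) (triangleBundle_adj_none (by simp))
  · exact iff_of_true (hc _ (hU j').1) (triangleBundle_adj_none (by simp))
  · exact iff_of_true (hc _ (hPc q)).symm (triangleBundle_adj_none (by simp)).symm
  · refine (hadjP q q').trans ?_
    obtain ⟨i, b⟩ := q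
    obtain ⟨j, b'⟩ := q'
    rw [triangleBundle, fromRel_adj]
    cases b <;> cases b' <;> simp [eq_comm]
  · refine iff_of_false (fun h => hPc q ((hU j').2 _ h.symm)) ?_
    simp [triangleBundle]
  · exact iff_of_true (hc _ (hU j).1).symm (triangleBundle_adj_none (by simp)).symm
  · refine iff_of_false (fun h => hPc q' ((hU j).2 _ h)) ?_
    simp [triangleBundle]
  · refine iff_of_false (fun h => (hU j').1 ((hU j).2 _ h)) ?_
    simp [triangleBundle]

end SimpleGraph

namespace SimpleGraph

variable {V : Type*} {G : SimpleGraph V} [Fintype V]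

lemma IsCactusOfOrder.nonempty_iso_iff {n k : ℕ} (hG : G.IsCactusOfOrder n k) :
    Nonempty (G ≃g extremalCactus n k) ↔ ∃ c, ∀ x, x ≠ c → G.Adj c x := by
  constructor
  · rintro ⟨φ⟩
    exact exists_universal_of_iso φ
  · rintro ⟨c, hc⟩
    obtain ⟨p, ⟨φ⟩⟩ := hG.isCactus.exists_iso_triangleBundle hc
    rw [hG.card_cycles] at φ
    have hcard := Fintype.card_congr φ.toEquiv
    rw [hG.card_verts] at hcard
    simp only [Fintype.card_option, Fintype.card_sum, Fintype.card_prod, Fintype.card_fin,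
      Fintype.card_bool] at hcard
    -- The order `1 + 2k + p = n` fixes the number of pendant edges.
    obtain rfl : p = n - 2 * k - 1 := by lia
    exact ⟨φ⟩

namespace IsCactus

/-! ### The two bounds and the case of equality -/

lemma exists_universal_of_edgeSzeged_eq (hG : G.IsCactus)
    (h1 : ∀ e ∈ G.edgeSet, (∀ C ∈ G.cycleSubgraphs, e ∉ C.edges) → (G.edgeSzegedTerm e : ℤ) = 0)
    (h2 : ∀ C ∈ G.cycleSubgraphs, C.edges.card = 3 ∧ ∀ e ∈ C.edges, G.edgeExcess e = 0) :
    ∃ c, ∀ x, x ≠ c → G.Adj c x := by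
  apply hG.connected.exists_universal
  intro u v huv
  by_cases hcyc : ∀ C ∈ G.cycleSubgraphs, s(u, v) ∉ C.edges
  · have h : G.edgeCloser u v * G.edgeCloser v u = 0 := Int.natCast_eq_zero.1 (h1 s(u, v) huv hcyc)
    exact (Nat.mul_eq_zero.1 h).imp (nested_of_edgeCloser_eq_zero hG.connected huv.ne)
      (nested_of_edgeCloser_eq_zero hG.connected huv.ne.symm)
  · push Not at hcyc
    obtain ⟨C, hC, he⟩ := hcyc
    obtain ⟨h3, h0⟩ := h2 C hC
    have h : ((G.edgeCloser u v : ℤ) - 1) * (G.edgeCloser v u - 1) = 0 := h0 _ he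
    have he : C.Adj u v := by simpa using he
    exact (mul_eq_zero.1 h).imp
      (fun h => nested_of_edgeCloser_eq_one hG.connected hC h3 he (by lia))
      (fun h => nested_of_edgeCloser_eq_one hG.connected hC h3 he.symm (by lia))

/-- An edge on no cycle of a cactus with a universal vertex is a pendant edge at that vertex. -/
lemma exists_pendant_of_universal {c : V} (hc : ∀ x, x ≠ c → G.Adj c x) {e : Sym2 V}
    (he : e ∈ G.edgeSet) (hcyc : ∀ C ∈ G.cycleSubgraphs, e ∉ C.edges) :
    ∃ x, x ≠ c ∧ e = s(c, x) ∧ ∀ y, G.Adj x y → y = c := by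
  suffices h : ∃ x, x ≠ c ∧ e = s(c, x) by
    obtain ⟨x, hx, rfl⟩ := h
    exact ⟨x, hx, rfl, eq_center_of_adj_of_notMem_cycle hc hx fun C hC => by
      simpa using hcyc C hC⟩
  induction e with | _ u v
  rcases eq_center_of_notMem_cycle hc he fun C hC => by simpa using hcyc C hC with rfl | rfl
  · exact ⟨v, (G.ne_of_adj he).symm, rfl⟩
  · exact ⟨u, G.ne_of_adj he, Sym2.eq_swap⟩

variable [Fintype G.edgeSet]

lemma edgeSzeged_bound (hG : G.IsCactus) (hn : 5 ≤ Fintype.card V) :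
    G.cycleSubgraphs.ncard * (2 * G.edgeFinset.card - 3 : ℤ) ≤ G.edgeSzeged ∧
      (G.edgeSzeged = G.cycleSubgraphs.ncard * (2 * G.edgeFinset.card - 3 : ℤ) ↔
        (∀ e ∈ G.edgeSet, (∀ C ∈ G.cycleSubgraphs, e ∉ C.edges) → (G.edgeSzegedTerm e : ℤ) = 0) ∧
          ∀ C ∈ G.cycleSubgraphs, C.edges.card = 3 ∧ ∀ e ∈ C.edges, G.edgeExcess e = 0) := by
  have h := hG.sum_edgeFinset_bound (fun e => (G.edgeSzegedTerm e : ℤ))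
    (2 * G.edgeFinset.card - 3) (fun _ _ _ => Int.natCast_nonneg _)
    (fun C hC => (hG.sum_edgeSzegedTerm_cycle hn hC).1)
  have hsum : (G.edgeSzeged : ℤ) = ∑ e ∈ G.edgeFinset, (G.edgeSzegedTerm e : ℤ) := by
    rw [← Nat.cast_sum]
    rfl
  rw [← hsum] at h
  refine ⟨h.1, h.2.trans (and_congr_right fun _ => forall₂_congr fun C hC => ?_)⟩
  exact (hG.sum_edgeSzegedTerm_cycle hn hC).2

lemma edgeVertexSzegedTerm_nonneg (hG : G.IsCactus) {e : Sym2 V} (he : e ∈ G.edgeSet)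
    (hcyc : ∀ C ∈ G.cycleSubgraphs, e ∉ C.edges) :
    0 ≤ (G.edgeVertexSzegedTerm e : ℤ) - (G.edgeFinset.card - 1) := by
  induction e with | _ u v
  rw [hG.edgeVertexSzegedTerm_of_notMem_cycle he hcyc]
  have h1 := hG.connected.vertCloser_pos (G.ne_of_adj he)
  have h2 := hG.connected.vertCloser_pos (G.ne_of_adj he).symm
  exact add_nonneg (mul_nonneg (by lia) (by lia)) (mul_nonneg (by lia) (by lia))

/-- `S` is twice the index, kept integral; `m(m - 1)` restores the `m - 1` subtracted from each of
the `m` terms. -/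
lemma edgeVertexSzeged_bound (hG : G.IsCactus) (hn : 5 ≤ Fintype.card V) :
    ∃ S : ℤ, G.edgeVertexSzeged = S / 2 ∧
      G.edgeFinset.card * (G.edgeFinset.card - 1 : ℤ) +
        G.cycleSubgraphs.ncard * (2 * Fintype.card V - G.edgeFinset.card - 3 : ℤ) ≤ S ∧
      (S = G.edgeFinset.card * (G.edgeFinset.card - 1 : ℤ) +
        G.cycleSubgraphs.ncard * (2 * Fintype.card V - G.edgeFinset.card - 3 : ℤ) ↔
        (∀ e ∈ G.edgeSet, (∀ C ∈ G.cycleSubgraphs, e ∉ C.edges) →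
          (G.edgeVertexSzegedTerm e : ℤ) - (G.edgeFinset.card - 1) = 0) ∧
        ∀ C ∈ G.cycleSubgraphs, C.edges.card = 3 ∧ ∀ e ∈ C.edges, G.edgeVertexExcess e = 0) := by
  have h := hG.sum_edgeFinset_bound
    (fun e => (G.edgeVertexSzegedTerm e : ℤ) - (G.edgeFinset.card - 1))
    (2 * Fintype.card V - G.edgeFinset.card - 3) (fun e he => hG.edgeVertexSzegedTerm_nonneg he)
    (fun C hC => (hG.sum_edgeVertexSzegedTerm_cycle hn hC).1)
  rw [Finset.sum_sub_distrib, Finset.sum_const, nsmul_eq_mul] at h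
  refine ⟨∑ e ∈ G.edgeFinset, (G.edgeVertexSzegedTerm e : ℤ), ?_, by lia, ?_⟩
  · rw [edgeVertexSzeged]
    push_cast
    rw [one_div, div_eq_inv_mul]
    rfl
  · rw [← sub_eq_iff_eq_add']
    refine h.2.trans (and_congr_right fun _ => forall₂_congr fun C hC => ?_)
    exact (hG.sum_edgeVertexSzegedTerm_cycle hn hC).2

lemma exists_universal_of_edgeVertexSzeged_eq (hG : G.IsCactus)
    (h1 : ∀ e ∈ G.edgeSet, (∀ C ∈ G.cycleSubgraphs, e ∉ C.edges) →
      (G.edgeVertexSzegedTerm e : ℤ) - (G.edgeFinset.card - 1) = 0)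
    (h2 : ∀ C ∈ G.cycleSubgraphs, C.edges.card = 3 ∧ ∀ e ∈ C.edges, G.edgeVertexExcess e = 0) :
    ∃ c, ∀ x, x ≠ c → G.Adj c x := by
  apply hG.connected.exists_universal
  intro u v huv
  have hu := hG.connected.vertCloser_pos huv.ne
  have hv := hG.connected.vertCloser_pos huv.ne.symm
  by_cases hcyc : ∀ C ∈ G.cycleSubgraphs, s(u, v) ∉ C.edges
  · have h := h1 s(u, v) huv hcyc
    rw [hG.edgeVertexSzegedTerm_of_notMem_cycle huv hcyc] at h
    -- Both summands vanish, but the first alone already gives the nesting.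
    have h := ((add_eq_zero_iff_of_nonneg (mul_nonneg (by lia) (by lia))
      (mul_nonneg (by lia) (by lia))).1 h).1
    exact (mul_eq_zero.1 h).imp
      (fun h => nested_of_vertCloser_eq_one hG.connected huv.ne (by lia))
      (fun h => nested_of_edgeCloser_eq_zero hG.connected huv.ne.symm (by lia))
  · push Not at hcyc
    obtain ⟨C, hC, he⟩ := hcyc
    obtain ⟨h3, h0⟩ := h2 C hC
    have h : ((G.vertCloser u v : ℤ) - 1) * (G.edgeCloser v u - 1) +
      ((G.vertCloser v u : ℤ) - 1) * (G.edgeCloser u v - 1) = 0 := h0 _ he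
    have he : C.Adj u v := by simpa using he
    have hu' := edgeCloser_pos_of_mem_cycleSubgraphs hG.connected hC he
    have hv' := edgeCloser_pos_of_mem_cycleSubgraphs hG.connected hC he.symm
    have h := ((add_eq_zero_iff_of_nonneg (mul_nonneg (by lia) (by lia))
      (mul_nonneg (by lia) (by lia))).1 h).1
    exact (mul_eq_zero.1 h).imp
      (fun h => nested_of_vertCloser_eq_one hG.connected huv.ne (by lia))
      (fun h => nested_of_edgeCloser_eq_one hG.connected hC h3 he.symm (by lia))

lemma edgeSzeged_eq_of_universal (hG : G.IsCactus) (hn : 5 ≤ Fintype.card V) {c : V}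
    (hc : ∀ x, x ≠ c → G.Adj c x) :
    G.edgeSzeged = G.cycleSubgraphs.ncard * (2 * G.edgeFinset.card - 3 : ℤ) := by
  refine (hG.edgeSzeged_bound hn).2.2 ⟨fun e he hcyc => ?_, fun C hC => ?_⟩
  · obtain ⟨x, hx, rfl, hx'⟩ := exists_pendant_of_universal hc he hcyc
    simp [edgeSzegedTerm, edgeCloser_center_eq_zero hG.connected hc hx']
  · obtain ⟨x, y, hx, hy, hxy, h3, h⟩ := hG.cycle_of_universal hc hC
    refine ⟨h3, fun e he => ?_⟩
    rcases h e he with rfl | rfl | rfl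
    · simp [edgeExcess, edgeCloser_center_eq_one hG hc hx hy hxy]
    · simp [edgeExcess, edgeCloser_center_eq_one hG hc hy hx hxy.symm]
    · simp [edgeExcess, edgeCloser_petal hG hc hx hy hxy]

lemma edgeVertexSzeged_conditions_of_universal (hG : G.IsCactus) {c : V}
    (hc : ∀ x, x ≠ c → G.Adj c x) :
    (∀ e ∈ G.edgeSet, (∀ C ∈ G.cycleSubgraphs, e ∉ C.edges) →
      (G.edgeVertexSzegedTerm e : ℤ) - (G.edgeFinset.card - 1) = 0) ∧
    ∀ C ∈ G.cycleSubgraphs, C.edges.card = 3 ∧ ∀ e ∈ C.edges, G.edgeVertexExcess e = 0 := by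
  refine ⟨fun e he hcyc => ?_, fun C hC => ?_⟩
  · obtain ⟨x, hx, rfl, hx'⟩ := exists_pendant_of_universal hc he hcyc
    rw [hG.edgeVertexSzegedTerm_of_notMem_cycle he hcyc]
    simp [edgeCloser_center_eq_zero hG.connected hc hx', vertCloser_center hG.connected hc hx]
  · obtain ⟨x, y, hx, hy, hxy, h3, h⟩ := hG.cycle_of_universal hc hC
    refine ⟨h3, fun e he => ?_⟩
    rcases h e he with rfl | rfl | rfl
    · simp [edgeVertexExcess, edgeCloser_center_eq_one hG hc hx hy hxy,
        vertCloser_center hG.connected hc hx]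
    · simp [edgeVertexExcess, edgeCloser_center_eq_one hG hc hy hx hxy.symm,
        vertCloser_center hG.connected hc hy]
    · simp [edgeVertexExcess, vertCloser_petal hG hc hx hy hxy,
        vertCloser_petal hG hc hy hx hxy.symm]

end IsCactus

end SimpleGraph

/-! ### The theorem, by substituting `m = n + k - 1`. -/

theorem theorem1p1 {V : Type*} [Fintype V] (G : SimpleGraph V) [Fintype G.edgeSet]
    (n k : ℕ) (hn : 5 ≤ n) (hG : G.IsCactusOfOrder n k) :
    (2 * k * n + 2 * k ^ 2 - 5 * k : ℤ) ≤ (G.edgeSzeged : ℤ) ∧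
    (n ^ 2 - 3 * n + 3 * k * n - 5 * k + 2 : ℚ) / 2 ≤ G.edgeVertexSzeged ∧
    ((G.edgeSzeged : ℤ) = 2 * k * n + 2 * k ^ 2 - 5 * k ↔
      Nonempty (G ≃g SimpleGraph.extremalCactus n k)) ∧
    (G.edgeVertexSzeged = (n ^ 2 - 3 * n + 3 * k * n - 5 * k + 2 : ℚ) / 2 ↔
      Nonempty (G ≃g SimpleGraph.extremalCactus n k)) := by
  have hC := hG.isCactus
  have hn' : 5 ≤ Fintype.card V := hG.card_verts.symm ▸ hn
  rw [hG.nonempty_iso_iff]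
  have hm := hC.card_edgeFinset_add_one
  obtain ⟨hE, hE'⟩ := hC.edgeSzeged_bound hn'
  obtain ⟨S, hS, hV, hV'⟩ := hC.edgeVertexSzeged_bound hn'
  have hEu (h : ∃ c, ∀ x, x ≠ c → G.Adj c x) := h.elim fun c => hC.edgeSzeged_eq_of_universal hn'
  rw [hG.card_cycles, hG.card_verts] at hm
  have hm' : (G.edgeFinset.card : ℤ) = k + n - 1 := by lia
  have hvE : (k * (2 * G.edgeFinset.card - 3) : ℤ) = 2 * k * n + 2 * k ^ 2 - 5 * k := by
    rw [hm']
    ring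
  have hvV : (G.edgeFinset.card * (G.edgeFinset.card - 1) +
      k * (2 * n - G.edgeFinset.card - 3) : ℤ) = n ^ 2 - 3 * n + 3 * k * n - 5 * k + 2 := by
    rw [hm']
    ring
  rw [hG.card_cycles, hvE] at hE hE' hEu
  rw [hG.card_cycles, hG.card_verts, hvV] at hV hV'
  have hcast : ((n ^ 2 - 3 * n + 3 * k * n - 5 * k + 2 : ℤ) : ℚ) =
      n ^ 2 - 3 * n + 3 * k * n - 5 * k + 2 := by
    push_cast
    ring
  rw [hS, ← hcast, div_left_inj' two_ne_zero, Int.cast_inj, div_le_div_iff_of_pos_right two_pos,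
    Int.cast_le, hV', hE']
  refine ⟨hE, hV, ⟨fun h => hC.exists_universal_of_edgeSzeged_eq h.1 h.2, fun h => hE'.1 (hEu h)⟩,
    fun h => hC.exists_universal_of_edgeVertexSzeged_eq h.1 h.2, ?_⟩
  rintro ⟨c, hc⟩
  exact hC.edgeVertexSzeged_conditions_of_universal hc
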